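/- Let $k$ be a commutative ring and let $A$, $U$ be unital associative $k$-algebras. For an algebra $W$ with commuting algebra maps $s:A\to W$, $t:A^{\rm op}\to W$ (an $A\otimes_k A^{\rm op}$-ring) write $a\triangleright w\triangleleft b=s(a)t(b)w$ and $a\blacktriangleright w\blacktriangleleft b=w\,s(b)t(a)$; a triangle at $W$ shows which action enters a tensor product. Let $(U,A,s,t,\Delta,\varepsilon)$ be a left bialgebroid, i.e. $(U,\Delta,\varepsilon)$ is an $A$-coring for the bimodule structure $\triangleright,\triangleleft$, with $\Delta(u)=u_{(1)}\otimes_A u_{(2)}\in U_\triangleleft\otimes_A{}_\triangleright U$, such that $a\blacktriangleright u_{(1)}\otimes_A u_{(2)}=u_{(1)}\otimes_A u_{(2)}\blacktriangleleft a$, $\Delta(1)=1\otimes_A 1$, $\Delta(uv)=\Delta(u)\Delta(v)$, $\varepsilon(1)=1$ and $\varepsilon(uv)=\varepsilon(u\,s(\varepsilon(v)))=\varepsilon(u\,t(\varepsilon(v)))$. Assume that $U$ is a left Hopf algebroid, i.e. that $${}_\blacktriangleright U\otimes_{A^{\rm op}}U_\triangleleft\to U_\triangleleft\otimes_A{}_\triangleright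 U,\qquad u\otimes_{A^{\rm op}}u'\mapsto u_{(1)}\otimes_A u_{(2)}u',$$ is bijective, and write $u_+\otimes_{A^{\rm op}}u_-$ for the preimage of $u\otimes_A 1$. Assume that the right $A$-module $U_\triangleleft$ is finitely generated projective. Let $U^*={\rm Hom}_{A^{\rm op}}(U_\triangleleft,A)$ be the right dual (the right $A$-linear maps $U_\triangleleft\to A$), which is an $A\otimes_k A^{\rm op}$-ring with product $(\phi\psi)(u)=\psi(\phi(u_{(1)})\triangleright u_{(2)})$, unit $\varepsilon$, source map $a\mapsto\varepsilon((\cdot)\blacktriangleleft a)$ and target map $a\mapsto\varepsilon(a\triangleright(\cdot))$. For $u\in U$, $\phi\in U^*$ let $u\rightharpoonup\phi\in U^*$ and $u\rightharpoondown\phi\in U^*$ be given by $(u\rightharpoonup\phi)(v)=\phi(vu)$ and $(u\rightharpoondown\phi)(v)=\varepsilon(\phi(u_-v)\blacktriangleright u_+)$. A dual basis consists of $e_1,\dots,e_n\in U$ and $e^1,\dots,e^n\in U^*$ with $u=\sum_i e_i\triangleleft e^i(u)$ for all $u\in U$. **Theorem.** $U^*$ is a right bialgebroid over $A$ (the axioms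 are those of a left bialgebroid for the opposite algebra with source and target exchanged; the coring structure is over $\blacktriangleright,\blacktriangleleft$). Its counit is $\phi\mapsto\phi(1)$. Its coproduct $\phi\mapsto\phi^{(1)}\otimes_A\phi^{(2)}\in U^*_\blacktriangleleft\otimes_A{}_\blacktriangleright U^*$ is the unique element with $\phi^{(1)}(\phi^{(2)}(v)\blacktriangleright u)=\phi(uv)$ for all $u,v\in U$, and equals $\sum_i(e_i\rightharpoonup\phi)\otimes_A e^i$ for every dual basis. Moreover, $U^*$ is a right Hopf algebroid, i.e. the Hopf–Galois map $$\beta:{}_\blacktriangleright U^*\otimes_{A^{\rm op}}U^*_\triangleleft\to U^*_\blacktriangleleft\otimes_A{}_\blacktriangleright U^*,\qquad \phi\otimes_{A^{\rm op}}\psi\mapsto\phi\psi^{(1)}\otimes_A\psi^{(2)},$$ is bijective. Its translation map $\tilde\beta^{-1}(\phi)=\phi^-\otimes_{A^{\rm op}}\phi^+:=\beta^{-1}(\varepsilon\otimes_A\phi)$ is given by $$(\tilde\beta^{-1}(\phi))(u\otimes_A v)=(u\rightharpoondown\phi)(v)=\varepsilon(\phi(u_-v)\blacktriangleright u_+)\qquad(u,v\in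 U),$$ where $\chi\otimes_{A^{\rm op}}\psi\in{}_\blacktriangleright U^*\otimes_{A^{\rm op}}U^*_\triangleleft$ is regarded as the function $u\otimes_A v\mapsto\psi(\chi(u)\triangleright v)$, and $\tilde\beta^{-1}(\phi)$ is the only element of the tensor product with this property. For every dual basis, $$\phi^-\otimes_{A^{\rm op}}\phi^+=\sum_i e^i\otimes_{A^{\rm op}}(e_i\rightharpoondown\phi),\qquad \beta^{-1}(\phi\otimes_A\psi)=\sum_i\phi e^i\otimes_{A^{\rm op}}(e_i\rightharpoondown\psi)\qquad(\phi,\psi\in U^*).$$ -/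

import Mathlib

open scoped TensorProduct
open MulOpposite

noncomputable section

/-! ## Balanced tensor products over a noncommutative ring -/

section Balanced

variable {k A M N P M' N' : Type*} [CommRing k]
  [AddCommGroup M] [Module k M] [AddCommGroup N] [Module k N] [AddCommGroup P] [Module k P]
  [AddCommGroup M'] [Module k M'] [AddCommGroup N'] [Module k N']

/-- The `k`-submodule of `M ⊗[k] N` generated by all `(m · a) ⊗ n - m ⊗ (a · n)`, where
`m · a = r a m` and `a · n = l a n`. -/
def balancedRel (r : A → Module.End k M) (l : A → Module.End k N) : Submodule k (M ⊗[k] N) :=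
  Submodule.span k {x | ∃ (a : A) (m : M) (n : N), x = r a m ⊗ₜ[k] n - m ⊗ₜ[k] l a n}

/-- The tensor product `M ⊗_A N` over the (noncommutative) `k`-algebra `A`, of `M` with right
action `m · a = r a m` and `N` with left action `a · n = l a n`, as a quotient of `M ⊗[k] N`.
If `r` is a left action and `l` is a right action of `A`, this is the tensor product over the
opposite algebra of `A`. -/
abbrev BalTensor (r : A → Module.End k M) (l : A → Module.End k N) : Type _ :=
  (M ⊗[k] N) ⧸ balancedRel r l

namespace BalTensor

/-- The canonical projection `M ⊗[k] N → M ⊗_A N`. -/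
def mk (r : A → Module.End k M) (l : A → Module.End k N) : (M ⊗[k] N) →ₗ[k] BalTensor r l :=
  (balancedRel r l).mkQ

/-- The canonical bilinear map `(m, n) ↦ m ⊗_A n`. -/
def tmul (r : A → Module.End k M) (l : A → Module.End k N) : M →ₗ[k] N →ₗ[k] BalTensor r l :=
  (TensorProduct.mk k M N).compr₂ (mk r l)

variable {r : A → Module.End k M} {l : A → Module.End k N}
  {r' : A → Module.End k M'} {l' : A → Module.End k N'}

theorem mk_tmul (m : M) (n : N) : mk r l (m ⊗ₜ[k] n) = tmul r l m n := rfl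

theorem mk_surjective : Function.Surjective (mk r l) := Submodule.mkQ_surjective _

theorem balanced (a : A) (m : M) (n : N) : tmul r l (r a m) n = tmul r l m (l a n) := by
  rw [← mk_tmul, ← mk_tmul, ← sub_eq_zero, ← map_sub]
  exact (Submodule.Quotient.mk_eq_zero _).2 (Submodule.subset_span ⟨a, m, n, rfl⟩)

/-- The linear map on `M ⊗_A N` induced by a balanced bilinear map. -/
def lift (f : M →ₗ[k] N →ₗ[k] P) (h : ∀ a m n, f (r a m) n = f m (l a n)) :
    BalTensor r l →ₗ[k] P :=
  (balancedRel r l).liftQ (TensorProduct.lift f) (by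
    refine Submodule.span_le.2 ?_
    rintro x ⟨a, m, n, rfl⟩
    simp [h])

@[simp] theorem lift_tmul (f : M →ₗ[k] N →ₗ[k] P) (h : ∀ a m n, f (r a m) n = f m (l a n))
    (m : M) (n : N) : lift f h (tmul r l m n) = f m n := by
  rw [← mk_tmul]
  exact TensorProduct.lift.tmul m n

/-- Two linear maps on `M ⊗_A N` that agree on all `m ⊗_A n` are equal. -/
theorem hom_ext {f g : BalTensor r l →ₗ[k] P}
    (h : ∀ m n, f (tmul r l m n) = g (tmul r l m n)) : f = g := by
  apply Submodule.linearMap_qext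
  apply TensorProduct.ext'
  exact h

/-- The map `m ⊗_A n ↦ f m ⊗_A g n`. -/
def map (f : M →ₗ[k] M') (g : N →ₗ[k] N') (hf : ∀ a m, f (r a m) = r' a (f m))
    (hg : ∀ a n, g (l a n) = l' a (g n)) : BalTensor r l →ₗ[k] BalTensor r' l' :=
  lift ((tmul r' l').compl₁₂ f g) (fun a m n => by simp [hf, hg, balanced])

@[simp] theorem map_tmul (f : M →ₗ[k] M') (g : N →ₗ[k] N') (hf : ∀ a m, f (r a m) = r' a (f m))
    (hg : ∀ a n, g (l a n) = l' a (g n)) (m : M) (n : N) :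
    map f g hf hg (tmul r l m n) = tmul r' l' (f m) (g n) := by
  simp [map]

end BalTensor

end Balanced

/-! ## Bimodules and corings -/

/-- An `A`-bimodule structure (with symmetric action of `k`) on the `k`-module `M`:
`left a m` is `a · m` and `right a m` is `m · a`. -/
structure BimoduleStr (k A M : Type*) [CommRing k] [Ring A] [Algebra k A] [AddCommGroup M]
    [Module k M] where
  left : A →ₗ[k] Module.End k M
  right : A →ₗ[k] Module.End k M
  left_one : ∀ m, left 1 m = m
  left_mul : ∀ a b m, left (a * b) m = left a (left b m)
  right_one : ∀ m, right 1 m = m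
  right_mul : ∀ a b m, right (a * b) m = right b (right a m)
  left_right : ∀ a b m, left a (right b m) = right b (left a m)

section Coring

variable {k A C : Type*} [CommRing k] [Ring A] [Algebra k A] [AddCommGroup C] [Module k C]

namespace BimoduleStr

variable (X : BimoduleStr k A C)

/-- The tensor square `C ⊗_A C` of a bimodule. -/
abbrev Sq : Type _ := BalTensor X.right X.left

/-- The left action `a · (c ⊗ d) = (a · c) ⊗ d` on `C ⊗_A C`. -/
def sqLeft (a : A) : X.Sq →ₗ[k] X.Sq :=
  BalTensor.map (X.left a) LinearMap.id (fun b m => X.left_right a b m) (fun _ _ => rfl)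

/-- The right action `(c ⊗ d) · a = c ⊗ (d · a)` on `C ⊗_A C`. -/
def sqRight (a : A) : X.Sq →ₗ[k] X.Sq :=
  BalTensor.map LinearMap.id (X.right a) (fun _ _ => rfl) (fun b m => (X.left_right b a m).symm)

/-- The tensor cube `(C ⊗_A C) ⊗_A C` of a bimodule. -/
abbrev Cube : Type _ := BalTensor X.sqRight X.left

/-- For fixed `c`, the map `C ⊗_A C → (C ⊗_A C) ⊗_A C`, `x ⊗ y ↦ (c ⊗ x) ⊗ y`. -/
def consCube (c : C) : X.Sq →ₗ[k] X.Cube :=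
  BalTensor.lift ((BalTensor.tmul X.sqRight X.left).comp (BalTensor.tmul X.right X.left c))
    (fun a m n => by
      have h := BalTensor.balanced (r := X.sqRight) (l := X.left) a
        (BalTensor.tmul X.right X.left c m) n
      simpa [sqRight] using h)

@[simp] theorem consCube_tmul (c x y : C) :
    X.consCube c (BalTensor.tmul X.right X.left x y) =
      BalTensor.tmul X.sqRight X.left (BalTensor.tmul X.right X.left c x) y := by
  simp [consCube]

theorem consCube_add (c d : C) : X.consCube (c + d) = X.consCube c + X.consCube d :=
  BalTensor.hom_ext (fun x y => by simp)

theorem consCube_smul (z : k) (c : C) : X.consCube (z • c) = z • X.consCube c :=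
  BalTensor.hom_ext (fun x y => by simp)

theorem consCube_right (a : A) (c : C) (x : X.Sq) :
    X.consCube (X.right a c) x = X.consCube c (X.sqLeft a x) := by
  have h : X.consCube (X.right a c) = (X.consCube c).comp (X.sqLeft a) :=
    BalTensor.hom_ext (fun x y => by simp [sqLeft, BalTensor.balanced])
  rw [h]
  rfl

end BimoduleStr

/-- The data of an `A`-coring: a coproduct and a counit, both maps of `A`-bimodules. -/
structure CoringData (X : BimoduleStr k A C) where
  comul : C →ₗ[k] X.Sq
  counit : C →ₗ[k] A
  comul_left : ∀ a c, comul (X.left a c) = X.sqLeft a (comul c)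
  comul_right : ∀ a c, comul (X.right a c) = X.sqRight a (comul c)
  counit_left : ∀ a c, counit (X.left a c) = a * counit c
  counit_right : ∀ a c, counit (X.right a c) = counit c * a

namespace CoringData

variable {X : BimoduleStr k A C} (D : CoringData X)

/-- The map `Δ ⊗ id : C ⊗_A C → (C ⊗_A C) ⊗_A C`. -/
def comulFst : X.Sq →ₗ[k] X.Cube :=
  BalTensor.map D.comul LinearMap.id (fun a c => D.comul_right a c) (fun _ _ => rfl)

/-- The map `id ⊗ Δ`, with `C ⊗_A (C ⊗_A C)` identified with `(C ⊗_A C) ⊗_A C`. -/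
def comulSnd : X.Sq →ₗ[k] X.Cube :=
  BalTensor.lift
    (LinearMap.mk₂ k (fun c d => X.consCube c (D.comul d))
      (fun c d e => by simp [BimoduleStr.consCube_add])
      (fun z c d => by simp [BimoduleStr.consCube_smul])
      (fun c d e => by simp)
      (fun z c d => by simp))
    (fun a c d => by simp [BimoduleStr.consCube_right, D.comul_left])

/-- The map `c ⊗ d ↦ ε(c) · d`. -/
def counitFst : X.Sq →ₗ[k] C :=
  BalTensor.lift (X.left.comp D.counit)
    (fun a c d => by simp [D.counit_right, X.left_mul])

/-- The map `c ⊗ d ↦ c · ε(d)`. -/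
def counitSnd : X.Sq →ₗ[k] C :=
  BalTensor.lift (X.right.comp D.counit).flip
    (fun a c d => by simp [D.counit_left, X.right_mul])

theorem counitFst_tmul (c d : C) :
    D.counitFst (BalTensor.tmul X.right X.left c d) = X.left (D.counit c) d :=
  BalTensor.lift_tmul _ _ _ _

theorem counitSnd_tmul (c d : C) :
    D.counitSnd (BalTensor.tmul X.right X.left c d) = X.right (D.counit d) c :=
  BalTensor.lift_tmul _ _ _ _

end CoringData

/-- An `A`-coring with underlying `A`-bimodule `X`. -/
structure Coring (X : BimoduleStr k A C) extends CoringData X where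
  coassoc : ∀ c, toCoringData.comulFst (comul c) = toCoringData.comulSnd (comul c)
  counit_fst : ∀ c, toCoringData.counitFst (comul c) = c
  counit_snd : ∀ c, toCoringData.counitSnd (comul c) = c

end Coring

/-! ## `A ⊗ Aᵒᵖ`-rings -/

/-- The structure of an `A ⊗ Aᵒᵖ`-ring on the `k`-algebra `U`. A `k`-algebra map
`A ⊗ Aᵒᵖ → U` is given by the source map `s` and the target map `t`, algebra maps on `A` and on
`Aᵒᵖ` with commuting images. -/
structure AeRing (k A U : Type*) [CommRing k] [Ring A] [Algebra k A] [Ring U] [Algebra k U] where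
  s : A →ₐ[k] U
  t : Aᵐᵒᵖ →ₐ[k] U
  comm : ∀ a b, s a * t b = t b * s a

section Bialgebroid

variable {k A U V : Type*} [CommRing k] [Ring A] [Algebra k A] [Ring U] [Algebra k U]
  [Ring V] [Algebra k V]

namespace AeRing

variable (E : AeRing k A U)

/-- The bimodule structure `a ▷ u ◁ b = s(a) t(b) u` on `U`. -/
def outer : BimoduleStr k A U where
  left := (LinearMap.mul k U).comp E.s.toLinearMap
  right := (LinearMap.mul k U).comp
    (E.t.toLinearMap.comp (opLinearEquiv k : A ≃ₗ[k] Aᵐᵒᵖ).toLinearMap)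
  left_one m := by simp
  left_mul a b m := by simp [mul_assoc]
  right_one m := by simp
  right_mul a b m := by simp [mul_assoc]
  left_right a b m := by simp [← mul_assoc, E.comm]

/-- The bimodule structure `a ▶ u ◀ b = u s(b) t(a)` on `U`. -/
def inner : BimoduleStr k A U where
  left := (LinearMap.mul k U).flip.comp
    (E.t.toLinearMap.comp (opLinearEquiv k : A ≃ₗ[k] Aᵐᵒᵖ).toLinearMap)
  right := (LinearMap.mul k U).flip.comp E.s.toLinearMap
  left_one m := by simp
  left_mul a b m := by simp [mul_assoc]
  right_one m := by simp
  right_mul a b m := by simp [mul_assoc]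
  left_right a b m := by simp [mul_assoc, E.comm]

@[simp] theorem outer_left (a : A) (u : U) : E.outer.left a u = E.s a * u := rfl
@[simp] theorem outer_right (a : A) (u : U) : E.outer.right a u = E.t (op a) * u := rfl
@[simp] theorem inner_left (a : A) (u : U) : E.inner.left a u = u * E.t (op a) := rfl
@[simp] theorem inner_right (a : A) (u : U) : E.inner.right a u = u * E.s a := rfl

/-- The right `A`-module `U_◁` with `u · a = u ◁ a = t(a) u`, in Mathlib's convention that right
`A`-modules are left modules over the opposite ring. -/
@[reducible] def ractModule : Module Aᵐᵒᵖ U := Module.compHom U E.t.toRingHom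

/-- The right `A`-module `U_◁` is finitely generated and projective. -/
def RactFGProjective : Prop :=
  @Module.Finite Aᵐᵒᵖ U _ _ E.ractModule ∧ @Module.Projective Aᵐᵒᵖ _ U _ E.ractModule

/-- The tensor product `▶U ⊗_{Aᵒᵖ} U_◁`, in which `(a ▶ u) ⊗ v = u ⊗ (v ◁ a)`. -/
abbrev OpTensor : Type _ := BalTensor E.inner.left E.outer.right

/-- The element `u ⊗ v` of `▶U ⊗_{Aᵒᵖ} U_◁`. -/
abbrev opTmul (u v : U) : E.OpTensor := BalTensor.tmul E.inner.left E.outer.right u v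

/-- The element `u ⊗ v` of `U_◁ ⊗_A ▷U`, in which `(u ◁ a) ⊗ v = u ⊗ (a ▷ v)`. -/
abbrev outerTmul (u v : U) : E.outer.Sq := BalTensor.tmul E.outer.right E.outer.left u v

/-- The element `u ⊗ v` of `U_◀ ⊗_A ▶U`, in which `(u ◀ a) ⊗ v = u ⊗ (a ▶ v)`. -/
abbrev innerTmul (u v : U) : E.inner.Sq := BalTensor.tmul E.inner.right E.inner.left u v

/-- The projection `U ⊗[k] U → U_◁ ⊗_A ▷U`. -/
abbrev outerMk : U ⊗[k] U →ₗ[k] E.outer.Sq := BalTensor.mk E.outer.right E.outer.left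

/-- The projection `U ⊗[k] U → U_◀ ⊗_A ▶U`. -/
abbrev innerMk : U ⊗[k] U →ₗ[k] E.inner.Sq := BalTensor.mk E.inner.right E.inner.left

/-- `u ⊗ v ↦ (a ▶ u) ⊗ v` on `U_◁ ⊗_A ▷U`. -/
def outerTakFst (a : A) : E.outer.Sq →ₗ[k] E.outer.Sq :=
  BalTensor.map (E.inner.left a) LinearMap.id (fun b m => by simp [mul_assoc]) (fun _ _ => rfl)

/-- `u ⊗ v ↦ u ⊗ (v ◀ a)` on `U_◁ ⊗_A ▷U`. -/
def outerTakSnd (a : A) : E.outer.Sq →ₗ[k] E.outer.Sq :=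
  BalTensor.map LinearMap.id (E.inner.right a) (fun _ _ => rfl) (fun b m => by simp [mul_assoc])

/-- `u ⊗ v ↦ (a ▷ u) ⊗ v` on `U_◀ ⊗_A ▶U`. -/
def innerTakFst (a : A) : E.inner.Sq →ₗ[k] E.inner.Sq :=
  BalTensor.map (E.outer.left a) LinearMap.id (fun b m => by simp [mul_assoc]) (fun _ _ => rfl)

/-- `u ⊗ v ↦ u ⊗ (v ◁ a)` on `U_◀ ⊗_A ▶U`. -/
def innerTakSnd (a : A) : E.inner.Sq →ₗ[k] E.inner.Sq :=
  BalTensor.map LinearMap.id (E.outer.right a) (fun _ _ => rfl) (fun b m => by simp [mul_assoc])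

/-- `u ⊗ v ↦ (u ◁ a) ⊗ v` on `▶U ⊗_{Aᵒᵖ} U_◁`. -/
def opTakFst (a : A) : E.OpTensor →ₗ[k] E.OpTensor :=
  BalTensor.map (E.outer.right a) LinearMap.id (fun b m => by simp [mul_assoc]) (fun _ _ => rfl)

/-- `u ⊗ v ↦ u ⊗ (a ▶ v)` on `▶U ⊗_{Aᵒᵖ} U_◁`. -/
def opTakSnd (a : A) : E.OpTensor →ₗ[k] E.OpTensor :=
  BalTensor.map LinearMap.id (E.inner.left a) (fun _ _ => rfl) (fun b m => by simp [mul_assoc])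

theorem opTakFst_tmul (a : A) (u v : U) :
    E.opTakFst a (E.opTmul u v) = E.opTmul (E.outer.right a u) v :=
  BalTensor.map_tmul _ _ _ _ _ _

theorem opTakSnd_tmul (a : A) (u v : U) :
    E.opTakSnd a (E.opTmul u v) = E.opTmul u (E.inner.left a v) :=
  BalTensor.map_tmul _ _ _ _ _ _

/-- The map sending `u ⊗ v` in `U_◁ ⊗_A ▷U` and `w` to `u ⊗ v w`. -/
def outerMulSnd : E.outer.Sq →ₗ[k] U →ₗ[k] E.outer.Sq :=
  BalTensor.lift
    (LinearMap.mk₂ k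
      (fun u v => (BalTensor.tmul E.outer.right E.outer.left u).comp (LinearMap.mul k U v))
      (fun _ _ _ => by ext; simp) (fun _ _ _ => by ext; simp)
      (fun _ _ _ => by ext; simp [add_mul]) (fun _ _ _ => by ext; simp))
    (fun a u v => by
      ext w
      have h := BalTensor.balanced (r := E.outer.right) (l := E.outer.left) a u (v * w)
      simpa [mul_assoc] using h)

@[simp] theorem outerMulSnd_tmul (u v w : U) :
    E.outerMulSnd (E.outerTmul u v) w = E.outerTmul u (v * w) := by
  simp [outerMulSnd, outerTmul]

/-- The map sending `u ⊗ v` in `U_◀ ⊗_A ▶U` and `w` to `w u ⊗ v`. -/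
def innerMulFst : E.inner.Sq →ₗ[k] U →ₗ[k] E.inner.Sq :=
  BalTensor.lift
    (LinearMap.mk₂ k
      (fun u v =>
        ((BalTensor.tmul E.inner.right E.inner.left).flip v).comp ((LinearMap.mul k U).flip u))
      (fun _ _ _ => by ext; simp [mul_add]) (fun _ _ _ => by ext; simp)
      (fun _ _ _ => by ext; simp) (fun _ _ _ => by ext; simp))
    (fun a u v => by
      ext w
      have h := BalTensor.balanced (r := E.inner.right) (l := E.inner.left) a (w * u) v
      simpa [mul_assoc] using h)

@[simp] theorem innerMulFst_tmul (u v w : U) :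
    E.innerMulFst (E.innerTmul u v) w = E.innerTmul (w * u) v := by
  simp [innerMulFst, innerTmul]

end AeRing

/-! ## Left and right bialgebroids -/

/-- A left bialgebroid `(U, A, s, t, Δ, ε)` on the `A ⊗ Aᵒᵖ`-ring `(U, A, s, t)`. In `comul_mul`,
elements of `U_◁ ⊗_A ▷U` in the Sweedler-Takeuchi product are multiplied factorwise; this does not
depend on the chosen representatives in `U ⊗[k] U`. -/
structure LeftBialgebroid (E : AeRing k A U) extends Coring E.outer where
  takeuchi : ∀ a u, E.outerTakFst a (comul u) = E.outerTakSnd a (comul u)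
  comul_one : comul 1 = E.outerTmul 1 1
  comul_mul : ∀ (u v : U) (x y : U ⊗[k] U), comul u = E.outerMk x → comul v = E.outerMk y →
    comul (u * v) = E.outerMk (x * y)
  counit_one : counit 1 = 1
  counit_mul_s : ∀ u v, counit (u * v) = counit (u * E.s (counit v))
  counit_mul_t : ∀ u v, counit (u * v) = counit (u * E.t (op (counit v)))

/-- A right bialgebroid `(V, A, s, t, Δ, ∂)` on the `A ⊗ Aᵒᵖ`-ring `(V, A, s, t)`. In `comul_mul`,
elements of `V_◀ ⊗_A ▶V` in the Sweedler-Takeuchi product are multiplied factorwise; this does not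
depend on the chosen representatives in `V ⊗[k] V`. -/
structure RightBialgebroid (E : AeRing k A V) extends Coring E.inner where
  takeuchi : ∀ a v, E.innerTakFst a (comul v) = E.innerTakSnd a (comul v)
  comul_one : comul 1 = E.innerTmul 1 1
  comul_mul : ∀ (v w : V) (x y : V ⊗[k] V), comul v = E.innerMk x → comul w = E.innerMk y →
    comul (v * w) = E.innerMk (x * y)
  counit_one : counit 1 = 1
  counit_mul_s : ∀ v w, counit (v * w) = counit (E.s (counit v) * w)
  counit_mul_t : ∀ v w, counit (v * w) = counit (E.t (op (counit v)) * w)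

namespace LeftBialgebroid

variable {E : AeRing k A U} (B : LeftBialgebroid E)

theorem comul_mul_t_eq (u : U) (a : A) (x : U ⊗[k] U) (hx : B.comul u = E.outerMk x) :
    B.comul (u * E.t (op a)) = E.outerMk (x * (1 ⊗ₜ E.t (op a))) := by
  refine B.comul_mul u _ x _ hx ?_
  have h := B.comul_right a 1
  rw [B.comul_one] at h
  simpa [BimoduleStr.sqRight, BalTensor.mk_tmul, AeRing.outerTmul] using h

theorem comul_mul_s_eq (u : U) (a : A) (x : U ⊗[k] U) (hx : B.comul u = E.outerMk x) :
    B.comul (u * E.s a) = E.outerMk (x * (E.s a ⊗ₜ 1)) := by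
  refine B.comul_mul u _ x _ hx ?_
  have h := B.comul_left a 1
  rw [B.comul_one] at h
  simpa [BimoduleStr.sqLeft, BalTensor.mk_tmul, AeRing.outerTmul] using h

theorem comul_mul_t (u : U) (a : A) (w : U) :
    E.outerMulSnd (B.comul (u * E.t (op a))) w = E.outerMulSnd (B.comul u) (E.t (op a) * w) := by
  obtain ⟨x, hx⟩ := BalTensor.mk_surjective (B.comul u)
  rw [B.comul_mul_t_eq u a x hx.symm, ← hx]
  clear hx
  induction x with
  | zero => simp
  | add x y hx hy => rw [add_mul, map_add, map_add, map_add, map_add]; simp [hx, hy]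
  | tmul p q =>
    rw [Algebra.TensorProduct.tmul_mul_tmul, mul_one]
    simp only [AeRing.outerMk, BalTensor.mk_tmul]
    rw [E.outerMulSnd_tmul, E.outerMulSnd_tmul, mul_assoc]

/-- The Hopf-Galois map `▶U ⊗_{Aᵒᵖ} U_◁ → U_◁ ⊗_A ▷U`, `u ⊗ u' ↦ u₍₁₎ ⊗ u₍₂₎ u'`. -/
def galois : E.OpTensor →ₗ[k] E.outer.Sq :=
  BalTensor.lift (E.outerMulSnd.comp B.comul) (fun a u w => B.comul_mul_t u a w)

/-- The left bialgebroid is a left Hopf algebroid. -/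
def IsLeftHopf : Prop := Function.Bijective B.galois

variable {B} in
/-- The translation map `u ↦ u₊ ⊗ u₋`, the preimage of `u ⊗ 1` under the Hopf-Galois map. -/
def IsLeftHopf.translation (h : B.IsLeftHopf) (u : U) : E.OpTensor :=
  (LinearEquiv.ofBijective B.galois h).symm (E.outerTmul u 1)

end LeftBialgebroid

namespace RightBialgebroid

variable {E : AeRing k A V} (D : RightBialgebroid E)

theorem comul_t_mul (v : V) (a : A) (w : V) :
    E.innerMulFst (D.comul v) (w * E.t (op a)) = E.innerMulFst (D.comul (E.t (op a) * v)) w := by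
  obtain ⟨x, hx⟩ := BalTensor.mk_surjective (D.comul v)
  have ht : D.comul (E.t (op a)) = E.innerMk (E.t (op a) ⊗ₜ 1) := by
    have h := D.comul_left a 1
    rw [D.comul_one] at h
    simpa [BimoduleStr.sqLeft, BalTensor.mk_tmul, AeRing.innerTmul] using h
  rw [D.comul_mul _ v _ x ht hx.symm, ← hx]
  clear hx ht
  induction x with
  | zero => simp
  | add x y hx hy => rw [mul_add, map_add, map_add, map_add, map_add]; simp [hx, hy]
  | tmul p q =>
    rw [Algebra.TensorProduct.tmul_mul_tmul, one_mul]
    simp only [AeRing.innerMk, BalTensor.mk_tmul]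
    rw [E.innerMulFst_tmul, E.innerMulFst_tmul, mul_assoc]

/-- The Hopf-Galois map `▶V ⊗_{Aᵒᵖ} V_◁ → V_◀ ⊗_A ▶V`, `v' ⊗ v ↦ v' v⁽¹⁾ ⊗ v⁽²⁾`. -/
def galois : E.OpTensor →ₗ[k] E.inner.Sq :=
  BalTensor.lift (E.innerMulFst.comp D.comul).flip (fun a w v => D.comul_t_mul v a w)

/-- The right bialgebroid is a right Hopf algebroid. -/
def IsRightHopf : Prop := Function.Bijective D.galois

variable {D} in
/-- The inverse of the Hopf-Galois map. -/
def IsRightHopf.galoisInv (h : D.IsRightHopf) : E.inner.Sq →ₗ[k] E.OpTensor :=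
  (LinearEquiv.ofBijective D.galois h).symm.toLinearMap

variable {D} in
/-- The translation map `v ↦ v⁻ ⊗ v⁺`, the preimage of `1 ⊗ v` under the Hopf-Galois map. -/
def IsRightHopf.translation (h : D.IsRightHopf) (v : V) : E.OpTensor :=
  h.galoisInv (E.innerTmul 1 v)

end RightBialgebroid

/-! ## The right dual of a left bialgebroid -/

/-- The `k`-module of right `A`-linear maps `U_◁ → A`. (Additive right `A`-linear maps are
automatically `k`-linear, since `k` acts on `U` and on `A` through `A`.) -/
def AeRing.rightDual (E : AeRing k A U) : Submodule k (U →ₗ[k] A) where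
  carrier := {φ | ∀ (u : U) (a : A), φ (E.t (op a) * u) = φ u * a}
  add_mem' := by
    intro φ ψ hφ hψ u a
    simp [hφ u a, hψ u a, add_mul]
  zero_mem' := by
    intro u a
    simp
  smul_mem' := by
    intro c φ hφ u a
    simp [hφ u a]

namespace LeftBialgebroid

variable {E : AeRing k A U}

/-- The right dual `U^* = Hom_{Aᵒᵖ}(U_◁, A)` of a left bialgebroid. -/
def RightDual (_B : LeftBialgebroid E) : Type _ := E.rightDual

variable (B : LeftBialgebroid E)

namespace RightDual

variable {B}

instance : AddCommGroup B.RightDual := inferInstanceAs (AddCommGroup E.rightDual)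
instance : Module k B.RightDual := inferInstanceAs (Module k E.rightDual)

instance : FunLike B.RightDual U A where
  coe φ := φ.1
  coe_injective _ _ h := Subtype.ext (DFunLike.coe_injective h)

instance : LinearMapClass B.RightDual k U A where
  map_add φ := φ.1.map_add
  map_smulₛₗ φ := φ.1.map_smul

@[ext] theorem ext {φ ψ : B.RightDual} (h : ∀ u, φ u = ψ u) : φ = ψ := DFunLike.ext _ _ h

@[simp] theorem add_apply (φ ψ : B.RightDual) (u : U) : (φ + ψ) u = φ u + ψ u := rfl
@[simp] theorem zero_apply (u : U) : (0 : B.RightDual) u = 0 := rfl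
@[simp] theorem smul_apply (c : k) (φ : B.RightDual) (u : U) : (c • φ) u = c • φ u := rfl

theorem map_t_mul (φ : B.RightDual) (u : U) (a : A) : φ (E.t (op a) * u) = φ u * a := φ.2 u a

/-- A right `A`-linear map as an element of the dual. -/
def mk (f : U →ₗ[k] A) (hf : ∀ u a, f (E.t (op a) * u) = f u * a) : B.RightDual := ⟨f, hf⟩

@[simp] theorem mk_apply (f : U →ₗ[k] A) (hf : ∀ u a, f (E.t (op a) * u) = f u * a) (u : U) :
    (mk f hf : B.RightDual) u = f u := rfl

variable (B) in
/-- Evaluation as a bilinear map. -/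
def eval : B.RightDual →ₗ[k] U →ₗ[k] A where
  toFun φ := φ.1
  map_add' _ _ := rfl
  map_smul' _ _ := rfl

@[simp] theorem eval_apply (φ : B.RightDual) (u : U) : eval B φ u = φ u := rfl

/-- The map `u ⊗ v ↦ ψ(φ(u) ▷ v)` on `U_◁ ⊗_A ▷U`. -/
def convol (φ ψ : B.RightDual) : E.outer.Sq →ₗ[k] A :=
  BalTensor.lift
    ((LinearMap.mul k U).compr₂ (eval B ψ) |>.comp (E.s.toLinearMap.comp (eval B φ)))
    (fun a u v => by simp [map_t_mul, mul_assoc])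

@[simp] theorem convol_tmul (φ ψ : B.RightDual) (u v : U) :
    convol φ ψ (BalTensor.tmul E.outer.right E.outer.left u v) = ψ (E.s (φ u) * v) := by
  simp [convol]

theorem convol_sqRight (φ ψ : B.RightDual) (a : A) (x : E.outer.Sq) :
    convol φ ψ (E.outer.sqRight a x) = convol φ ψ x * a := by
  have h : (convol φ ψ).comp (E.outer.sqRight a) =
      (LinearMap.mulRight k a).comp (convol φ ψ) :=
    BalTensor.hom_ext (fun u v => by
      simp [BimoduleStr.sqRight, ← mul_assoc, E.comm]
      simp [mul_assoc, map_t_mul])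
  exact LinearMap.congr_fun h x

/-- The product `(φ ψ)(u) = ψ(φ(u₍₁₎) ▷ u₍₂₎)`. -/
instance : Mul B.RightDual where
  mul φ ψ := mk ((convol φ ψ).comp B.comul) (fun u a => by
    have h := B.comul_right a u
    simp only [AeRing.outer_right] at h
    simp [h, convol_sqRight])

/-- The unit is the counit of `U`. -/
instance : One B.RightDual where
  one := mk B.counit (fun u a => B.counit_right a u)

theorem mul_apply (φ ψ : B.RightDual) (u : U) : (φ * ψ) u = convol φ ψ (B.comul u) := rfl
theorem one_apply (u : U) : (1 : B.RightDual) u = B.counit u := rfl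

theorem convol_add_left (φ φ' ψ : B.RightDual) :
    convol (φ + φ') ψ = convol φ ψ + convol φ' ψ :=
  BalTensor.hom_ext (fun u v => by simp [add_mul])

theorem convol_add_right (φ ψ ψ' : B.RightDual) :
    convol φ (ψ + ψ') = convol φ ψ + convol φ ψ' :=
  BalTensor.hom_ext (fun u v => by simp)

theorem convol_smul_left (c : k) (φ ψ : B.RightDual) :
    convol (c • φ) ψ = c • convol φ ψ :=
  BalTensor.hom_ext (fun u v => by simp)

theorem convol_smul_right (c : k) (φ ψ : B.RightDual) :
    convol φ (c • ψ) = c • convol φ ψ :=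
  BalTensor.hom_ext (fun u v => by simp)

protected theorem one_mul (φ : B.RightDual) : 1 * φ = φ := by
  ext u
  have h : convol 1 φ = (eval B φ).comp B.counitFst :=
    BalTensor.hom_ext (fun u v => by simp [CoringData.counitFst_tmul, one_apply])
  rw [mul_apply, h, LinearMap.comp_apply, B.counit_fst, eval_apply]

protected theorem mul_one (φ : B.RightDual) : φ * 1 = φ := by
  ext u
  have h : convol φ 1 = (eval B φ).comp B.counitSnd :=
    BalTensor.hom_ext (fun u v => by
      have h := B.counit_left (φ u) v
      rw [AeRing.outer_left] at h
      simp [CoringData.counitSnd_tmul, one_apply, h, map_t_mul])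
  rw [mul_apply, h, LinearMap.comp_apply, B.counit_snd, eval_apply]

/-- The map `(x ⊗ y) ⊗ z ↦ χ(ψ(φ(x) ▷ y) ▷ z)`. -/
def convol₃ (φ ψ χ : B.RightDual) : E.outer.Cube →ₗ[k] A :=
  BalTensor.lift
    ((LinearMap.mul k U).compr₂ (eval B χ) |>.comp (E.s.toLinearMap.comp (convol φ ψ)))
    (fun a x v => by simp [convol_sqRight, mul_assoc])

@[simp] theorem convol₃_tmul (φ ψ χ : B.RightDual) (x : E.outer.Sq) (z : U) :
    convol₃ φ ψ χ (BalTensor.tmul E.outer.sqRight E.outer.left x z) =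
      χ (E.s (convol φ ψ x) * z) := by
  simp [convol₃]

protected theorem mul_assoc (φ ψ χ : B.RightDual) : φ * ψ * χ = φ * (ψ * χ) := by
  ext u
  have h₁ : convol (φ * ψ) χ = (convol₃ φ ψ χ).comp B.comulFst :=
    BalTensor.hom_ext (fun u v => by simp [CoringData.comulFst, mul_apply])
  have h₂ : convol φ (ψ * χ) = (convol₃ φ ψ χ).comp B.comulSnd :=
    BalTensor.hom_ext (fun u v => by
      have h := B.comul_left (φ u) v
      rw [AeRing.outer_left] at h
      have h' : (convol ψ χ).comp (E.outer.sqLeft (φ u)) =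
          (convol₃ φ ψ χ).comp (E.outer.consCube u) :=
        BalTensor.hom_ext (fun x y => by simp [BimoduleStr.sqLeft])
      have h'' := LinearMap.congr_fun h' (B.comul v)
      simp only [LinearMap.comp_apply] at h''
      simp [CoringData.comulSnd, mul_apply, h, h''])
  rw [mul_apply, h₁, mul_apply, h₂, LinearMap.comp_apply, LinearMap.comp_apply, B.coassoc]

instance : Ring B.RightDual :=
  { (inferInstance : AddCommGroup B.RightDual) with
    one_mul := RightDual.one_mul
    mul_one := RightDual.mul_one
    mul_assoc := RightDual.mul_assoc
    left_distrib := fun φ ψ χ => by ext u; simp [mul_apply, convol_add_right]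
    right_distrib := fun φ ψ χ => by ext u; simp [mul_apply, convol_add_left]
    zero_mul := fun φ => by
      ext u
      have h : convol 0 φ = 0 := BalTensor.hom_ext (fun u v => by simp)
      simp [mul_apply, h]
    mul_zero := fun φ => by
      ext u
      have h : convol φ 0 = 0 := BalTensor.hom_ext (fun u v => by simp)
      simp [mul_apply, h] }

instance : Algebra k B.RightDual :=
  Algebra.ofModule (fun c φ ψ => by ext u; simp [mul_apply, convol_smul_left])
    (fun c φ ψ => by ext u; simp [mul_apply, convol_smul_right])

theorem algebraMap_apply (c : k) (u : U) :
    (algebraMap k B.RightDual c) u = c • B.counit u := by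
  rw [Algebra.algebraMap_eq_smul_one, smul_apply, one_apply]

variable (B) in
/-- The source map of the dual: `a ↦ ε((·) ◀ a)`. -/
def sFun (a : A) : B.RightDual :=
  mk (B.counit.comp (E.inner.right a)) (fun u b => by
    have h := B.counit_right b (u * E.s a)
    simpa [mul_assoc] using h)

variable (B) in
/-- The target map of the dual: `a ↦ ε(a ▷ (·)) = a ε(·)`. -/
def tFun (a : A) : B.RightDual :=
  mk (B.counit.comp (E.outer.left a)) (fun u b => by
    have h := B.counit_right b (E.s a * u)
    rw [AeRing.outer_right] at h
    simp [← h, ← mul_assoc, E.comm])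

theorem sFun_apply (a : A) (u : U) : sFun B a u = B.counit (u * E.s a) := rfl
theorem tFun_apply (a : A) (u : U) : tFun B a u = B.counit (E.s a * u) := rfl

theorem counit_s_mul (a : A) (u : U) : B.counit (E.s a * u) = a * B.counit u :=
  B.counit_left a u

theorem sFun_mul (a : A) (φ : B.RightDual) (u : U) : (sFun B a * φ) u = φ (u * E.s a) := by
  obtain ⟨x, hx⟩ := BalTensor.mk_surjective (B.comul u)
  have h : convol (sFun B a) φ (E.outerMk x) =
      φ (B.counitFst (E.outerMk (x * (E.s a ⊗ₜ 1)))) := by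
    clear hx
    induction x with
    | zero => simp
    | add x y hx hy => rw [add_mul, map_add, map_add, map_add, map_add, map_add, hx, hy]
    | tmul p q =>
      rw [Algebra.TensorProduct.tmul_mul_tmul, mul_one]
      simp [AeRing.outerMk, BalTensor.mk_tmul, CoringData.counitFst_tmul, sFun_apply]
  rw [mul_apply, ← hx, h, ← B.comul_mul_s_eq u a x hx.symm, B.counit_fst]

theorem tFun_mul (a : A) (φ : B.RightDual) (u : U) : (tFun B a * φ) u = φ (E.s a * u) := by
  have h : convol (tFun B a) φ = (eval B φ).comp ((E.outer.left a).comp B.counitFst) :=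
    BalTensor.hom_ext (fun u v => by
      simp [CoringData.counitFst_tmul, tFun_apply, counit_s_mul, mul_assoc])
  rw [mul_apply, h]
  simp [B.counit_fst]

theorem mul_tFun (a : A) (φ : B.RightDual) (u : U) : (φ * tFun B a) u = a * φ u := by
  have h : convol φ (tFun B a) = (LinearMap.mulLeft k a).comp (convol φ 1) :=
    BalTensor.hom_ext (fun u v => by simp [tFun_apply, counit_s_mul, one_apply])
  rw [mul_apply, h, LinearMap.comp_apply, ← mul_apply, mul_one, LinearMap.mulLeft_apply]

theorem mul_sFun (a : A) (φ : B.RightDual) (u : U) :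
    (φ * sFun B a) u = φ (u * E.t (op a)) := by
  have ht : B.counit (E.t (op a)) = a := by
    have h := B.counit_right a 1
    simpa [B.counit_one] using h
  obtain ⟨x, hx⟩ := BalTensor.mk_surjective (B.comul u)
  have h : convol φ (sFun B a) (E.outerMk x) =
      φ (B.counitSnd (E.outerMk (x * (1 ⊗ₜ E.t (op a))))) := by
    clear hx
    induction x with
    | zero => simp
    | add x y hx hy => rw [add_mul, map_add, map_add, map_add, map_add, map_add, hx, hy]
    | tmul p q =>
      rw [Algebra.TensorProduct.tmul_mul_tmul, mul_one]
      simp [AeRing.outerMk, BalTensor.mk_tmul, CoringData.counitSnd_tmul, sFun_apply, map_t_mul,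
        B.counit_mul_s q (E.t (op a)), ht, mul_assoc, counit_s_mul]
  rw [mul_apply, ← hx, h, ← B.comul_mul_t_eq u a x hx.symm, B.counit_snd]

end RightDual

/-- The `A ⊗ Aᵒᵖ`-ring structure of the right dual, with source map `a ↦ ε((·) ◀ a)` and target map
`a ↦ ε(a ▷ (·))`. -/
def dualAeRing : AeRing k A B.RightDual where
  s :=
    { toFun := RightDual.sFun B
      map_one' := by ext u; simp [RightDual.sFun_apply, RightDual.one_apply]
      map_mul' := fun a b => by
        ext u
        rw [RightDual.sFun_mul]
        simp [RightDual.sFun_apply, mul_assoc]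
      map_zero' := by ext u; simp [RightDual.sFun_apply]
      map_add' := fun a b => by ext u; simp [RightDual.sFun_apply, mul_add]
      commutes' := fun c => by
        ext u
        simp [RightDual.sFun_apply, RightDual.algebraMap_apply, ← Algebra.commutes c u,
          ← Algebra.smul_def] }
  t :=
    { toFun := fun a => RightDual.tFun B a.unop
      map_one' := by ext u; simp [RightDual.tFun_apply, RightDual.one_apply]
      map_mul' := fun a b => by
        ext u
        rw [RightDual.tFun_mul]
        simp [RightDual.tFun_apply, mul_assoc]
      map_zero' := by ext u; simp [RightDual.tFun_apply]
      map_add' := fun a b => by ext u; simp [RightDual.tFun_apply, add_mul]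
      commutes' := fun c => by
        ext u
        simp [RightDual.tFun_apply, RightDual.algebraMap_apply, MulOpposite.algebraMap_apply,
          ← Algebra.smul_def] }
  comm a b := by
    ext u
    have h₁ := RightDual.sFun_mul a (RightDual.tFun B b.unop) u
    have h₂ := RightDual.tFun_mul b.unop (RightDual.sFun B a) u
    simp only [RightDual.tFun_apply, RightDual.sFun_apply] at h₁ h₂
    rw [← mul_assoc, ← h₂] at h₁
    exact h₁

theorem dualAeRing_s (a : A) : B.dualAeRing.s a = RightDual.sFun B a := rfl
theorem dualAeRing_t (a : A) : B.dualAeRing.t (op a) = RightDual.tFun B a := rfl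

/-- For `u, v` in `U`, the map `φ ⊗ ψ ↦ φ(ψ(v) ▶ u)` on `U^*_◀ ⊗_A ▶U^*`. -/
def coproductPairing (u v : U) : B.dualAeRing.inner.Sq →ₗ[k] A :=
  BalTensor.lift
    (LinearMap.mk₂ k (fun φ ψ : B.RightDual => φ (E.inner.left (ψ v) u))
      (fun _ _ _ => by simp) (fun _ _ _ => by simp)
      (fun _ _ _ => by simp [mul_add]) (fun _ _ _ => by simp))
    (fun a φ ψ => by
      simp [dualAeRing_s, dualAeRing_t, RightDual.mul_sFun, RightDual.mul_tFun, mul_assoc])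

/-- For `u, v` in `U`, the map `φ ⊗ ψ ↦ ψ(φ(u) ▷ v)` on `▶U^* ⊗_{Aᵒᵖ} U^*_◁`. -/
def translationPairing (u v : U) : B.dualAeRing.OpTensor →ₗ[k] A :=
  BalTensor.lift
    (LinearMap.mk₂ k (fun φ ψ : B.RightDual => ψ (E.outer.left (φ u) v))
      (fun _ _ _ => by simp [add_mul]) (fun _ _ _ => by simp)
      (fun _ _ _ => by simp) (fun _ _ _ => by simp))
    (fun a φ ψ => by
      simp [dualAeRing_t, RightDual.tFun_mul, RightDual.mul_tFun, mul_assoc])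

/-- The left `U`-action `(v ⇀ φ)(u) = φ(u v)` on the right dual. -/
def rmulAct (v : U) (φ : B.RightDual) : B.RightDual :=
  RightDual.mk ((RightDual.eval B φ).comp (LinearMap.mulRight k v))
    (fun u a => by simp [mul_assoc, RightDual.map_t_mul])

/-- The map `x ⊗ y ↦ (v ↦ ε(φ(y v) ▶ x))` on `▶U ⊗_{Aᵒᵖ} U_◁`. -/
def adjPairing (φ : B.RightDual) : E.OpTensor →ₗ[k] U →ₗ[k] A :=
  BalTensor.lift
    (LinearMap.mk₂ k
      (fun x y : U => B.counit.comp
        ((E.inner.left.flip x).comp ((RightDual.eval B φ).comp (LinearMap.mulLeft k y))))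
      (fun _ _ _ => by ext; simp [add_mul]) (fun _ _ _ => by ext; simp)
      (fun _ _ _ => by ext; simp [mul_add, add_mul]) (fun _ _ _ => by ext; simp))
    (fun a x y => by
      ext v
      simp [mul_assoc, RightDual.map_t_mul])

@[simp] theorem adjPairing_tmul (φ : B.RightDual) (x y v : U) :
    B.adjPairing φ (E.opTmul x y) v = B.counit (x * E.t (op (φ (y * v)))) := by
  simp [adjPairing, AeRing.opTmul]

variable {B}

theorem galois_tmul (x y : U) :
    B.galois (BalTensor.tmul E.inner.left E.outer.right x y) = E.outerMulSnd (B.comul x) y :=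
  BalTensor.lift_tmul _ _ _ _

namespace IsLeftHopf

variable (h : B.IsLeftHopf)

theorem galois_translation (u : U) : B.galois (h.translation u) = E.outerTmul u 1 :=
  (LinearEquiv.ofBijective B.galois h).apply_symm_apply _

/-- `(u₊ ◁ a) ⊗ u₋ = u₊ ⊗ (a ▶ u₋)`. -/
theorem takeuchi_translation (u : U) (a : A) :
    E.opTakFst a (h.translation u) = E.opTakSnd a (h.translation u) := by
  have key : ∀ (x : E.outer.Sq) (y : U),
      E.outerMulSnd (E.outer.sqRight a x) y = E.outer.sqRight a (E.outerMulSnd x y) := by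
    intro x y
    have e : (E.outerMulSnd.flip y).comp (E.outer.sqRight a) =
        (E.outer.sqRight a).comp (E.outerMulSnd.flip y) :=
      BalTensor.hom_ext (fun p q => by
        have h₁ := E.outerMulSnd_tmul p (E.t (op a) * q) y
        have h₂ := E.outerMulSnd_tmul p q y
        simp only [AeRing.outerTmul] at h₁ h₂
        simp [BimoduleStr.sqRight, h₁, h₂, mul_assoc])
    exact LinearMap.congr_fun e x
  have key' : ∀ (x : E.outer.Sq) (y : U),
      E.outerMulSnd x (y * E.t (op a)) = E.outerMulSnd (E.outerMulSnd x y) (E.t (op a)) := by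
    intro x y
    have e : E.outerMulSnd.flip (y * E.t (op a)) =
        (E.outerMulSnd.flip (E.t (op a))).comp (E.outerMulSnd.flip y) :=
      BalTensor.hom_ext (fun p q => by
        have h₁ := E.outerMulSnd_tmul p q (y * E.t (op a))
        have h₂ := E.outerMulSnd_tmul p q y
        have h₃ := E.outerMulSnd_tmul p (q * y) (E.t (op a))
        simp only [AeRing.outerTmul] at h₁ h₂ h₃
        simp [h₁, h₂, h₃, mul_assoc])
    exact LinearMap.congr_fun e x
  have e₁ : B.galois.comp (E.opTakFst a) = (E.outer.sqRight a).comp B.galois :=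
    BalTensor.hom_ext (fun x y => by
      have h₁ := E.opTakFst_tmul a x y
      have h₂ := B.comul_right a x
      simp only [AeRing.opTmul] at h₁
      simp only [LinearMap.comp_apply, h₁, galois_tmul, h₂, key])
  have e₂ : B.galois.comp (E.opTakSnd a) = (E.outerMulSnd.flip (E.t (op a))).comp B.galois :=
    BalTensor.hom_ext (fun x y => by
      have h₁ := E.opTakSnd_tmul a x y
      simp only [AeRing.opTmul] at h₁
      simp only [LinearMap.comp_apply, h₁, galois_tmul, LinearMap.flip_apply, ← key',
        AeRing.inner_left])
  apply h.1
  have e₁' := LinearMap.congr_fun e₁ (h.translation u)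
  have e₂' := LinearMap.congr_fun e₂ (h.translation u)
  simp only [LinearMap.comp_apply, h.galois_translation, LinearMap.flip_apply] at e₁' e₂'
  rw [e₁', e₂', E.outerMulSnd_tmul]
  simp [BimoduleStr.sqRight, AeRing.outerTmul]

/-- The element `u ⇁ φ` of the right dual, `(u ⇁ φ)(v) = ε(φ(u₋ v) ▶ u₊)`. -/
def adjAct (u : U) (φ : B.RightDual) : B.RightDual :=
  RightDual.mk (B.adjPairing φ (h.translation u)) (fun v a => by
    have hfg := h.takeuchi_translation u a
    have e₁ : ((B.adjPairing φ).flip v).comp (E.opTakSnd a) = (B.adjPairing φ).flip (E.t (op a) * v) :=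
      BalTensor.hom_ext (fun x y => by
        have h₁ := B.adjPairing_tmul φ x (y * E.t (op a)) v
        have h₂ := B.adjPairing_tmul φ x y (E.t (op a) * v)
        have h₀ := E.opTakSnd_tmul a x y
        simp only [AeRing.opTmul, AeRing.inner_left] at h₀ h₁ h₂
        simp [h₀, h₁, h₂, mul_assoc])
    have e₂ : ((B.adjPairing φ).flip v).comp (E.opTakFst a) =
        (LinearMap.mulRight k a).comp ((B.adjPairing φ).flip v) :=
      BalTensor.hom_ext (fun x y => by
        have h₁ := B.adjPairing_tmul φ (E.t (op a) * x) y v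
        have h₂ := B.adjPairing_tmul φ x y v
        have h₃ := B.counit_right a (x * E.t (op (φ (y * v))))
        have h₀ := E.opTakFst_tmul a x y
        simp only [AeRing.opTmul, AeRing.outer_right] at h₀ h₁ h₂ h₃
        simp [h₀, h₁, h₂, ← h₃, mul_assoc])
    have e₁' := LinearMap.congr_fun e₁ (h.translation u)
    have e₂' := LinearMap.congr_fun e₂ (h.translation u)
    simp only [LinearMap.comp_apply, LinearMap.flip_apply, LinearMap.mulRight_apply] at e₁' e₂'
    rw [← e₁', ← hfg, e₂'])

end IsLeftHopf

/-- `e₁, …, eₙ` in `U` and `e¹, …, eⁿ` in `U^*` form a dual basis of `U_◁`: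
`u = ∑ i, eᵢ ◁ eⁱ(u)` for all `u`. -/
def IsDualBasis {n : ℕ} (e : Fin n → U) (e' : Fin n → B.RightDual) : Prop :=
  ∀ u : U, u = ∑ i, E.outer.right (e' i u) (e i)

end LeftBialgebroid

end Bialgebroid

end

noncomputable section

namespace AeRing

variable {k A U : Type*} [CommRing k] [Ring A] [Algebra k A] [Ring U] [Algebra k U]
  (E : AeRing k A U)

/-! Everything is decided by evaluation on `U`. A dual basis of `U_◁` makes `▶U^*` finitely
generated projective as well, so tensors over `A` that involve `U^*` are determined by their values
on arguments from `U` (`coproductPairing_ext`, `translationPairing_ext`, `cube_ext`). Conversely, a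
function on `U_◁ ⊗_A ▷U` whose slices `v ↦ f(u ⊗ v)` lie in `U^*` is realised by a tensor
(`translationPairing_sum_tmul`).

Under this pairing the coproduct of `U^*` is the transpose of the multiplication of `U`.
Coassociativity and the counit laws are therefore associativity and the unit laws of `U`, and
grouplikeness of `ε` is the identity `ε(uv) = ε(u t(ε(v)))`. The axiom with real content is
multiplicativity. The dual acts on `U` from the right by `φ(u₍₁₎) ▷ u₍₂₎` (`hit`), and `(φψ)(u)` is
`ψ` evaluated at the result. Multiplicativity of the coproduct of `U` then says that `φ` acts on a
product `uv` through `φ⁽¹⁾` on `u` and `φ⁽²⁾` on `v` (`hitMul_eq_hit_mul`); `coproductPairing_mul`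
turns this into the axiom for `U^*`.

The Hopf-Galois map of `U^*` is the transpose of that of `U` (`coproductPairing_galois`). Since the
latter is bijective, `β(x) = y` means that, as a function, `x` is `y` composed with the inverse
Galois map of `U` (`galois_eq_iff`). That function has right `A`-linear slices, so it does come from
a tensor, and `β` is bijective. For `y = ε ⊗ φ` the slices are the elements `u ⇁ φ`
(`adjAct_apply`), which gives the translation map; left `U^*`-linearity of `β` yields the rest of
the inverse. -/

theorem outerTakFst_tmul (a : A) (u v : U) :
    E.outerTakFst a (BalTensor.tmul E.outer.right E.outer.left u v) =
      BalTensor.tmul E.outer.right E.outer.left (u * E.t (op a)) v :=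
  BalTensor.map_tmul _ _ _ _ _ _

theorem outerTakSnd_tmul (a : A) (u v : U) :
    E.outerTakSnd a (BalTensor.tmul E.outer.right E.outer.left u v) =
      BalTensor.tmul E.outer.right E.outer.left u (v * E.s a) :=
  BalTensor.map_tmul _ _ _ _ _ _

theorem innerTakFst_tmul (a : A) (u v : U) :
    E.innerTakFst a (BalTensor.tmul E.inner.right E.inner.left u v) =
      BalTensor.tmul E.inner.right E.inner.left (E.s a * u) v :=
  BalTensor.map_tmul _ _ _ _ _ _

theorem innerTakSnd_tmul (a : A) (u v : U) :
    E.innerTakSnd a (BalTensor.tmul E.inner.right E.inner.left u v) =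
      BalTensor.tmul E.inner.right E.inner.left u (E.t (op a) * v) :=
  BalTensor.map_tmul _ _ _ _ _ _

end AeRing

namespace LeftBialgebroid

variable {k A U : Type*} [CommRing k] [Ring A] [Algebra k A] [Ring U] [Algebra k U]
  {E : AeRing k A U} {B : LeftBialgebroid E}

/-! ## Dual bases -/

/-- A finitely generated projective right module `U_◁` has a dual basis. -/
theorem exists_isDualBasis (B : LeftBialgebroid E) (hU : E.RactFGProjective) :
    ∃ (n : ℕ) (e : Fin n → U) (e' : Fin n → B.RightDual), IsDualBasis e e' := by
  let := E.ractModule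
  obtain ⟨hf, hp⟩ := hU
  obtain ⟨n, f, g, -, -, hfg⟩ := Module.Finite.exists_comp_eq_id_of_projective Aᵐᵒᵖ U
  have hsmul : ∀ (a : Aᵐᵒᵖ) (u : U), a • u = E.t a * u := fun _ _ => rfl
  -- The `eᵢ` are the images of the standard basis under the surjection `f` from a free module, and
  -- the `eⁱ` are the coordinates of its section `g`.
  refine ⟨n, fun i => f (Pi.single i 1), fun i => RightDual.mk
    { toFun := fun u => (g u i).unop
      map_add' := fun u v => by simp
      map_smul' := fun c u => by
        -- `g` is only known to be `Aᵐᵒᵖ`-linear; a scalar from `k` acts through `Aᵐᵒᵖ` because `t`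
        -- is a `k`-algebra map.
        have h : c • u = (algebraMap k Aᵐᵒᵖ c) • u := by
          rw [hsmul, AlgHom.commutes, Algebra.smul_def]
        rw [h, map_smul, Pi.smul_apply, smul_eq_mul, ← Algebra.smul_def]
        simp }
    (fun u a => by
      change (g (E.t (op a) * u) i).unop = _
      rw [← hsmul, map_smul]
      simp), fun u => ?_⟩
  have h : f (g u) = u := LinearMap.congr_fun hfg u
  conv_lhs => rw [← h, ← Finset.univ_sum_single (g u), map_sum]
  refine Finset.sum_congr rfl fun i _ => ?_
  have h' : Pi.single i (g u i) = g u i • (Pi.single i 1 : Fin n → Aᵐᵒᵖ) := by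
    rw [← Pi.single_smul, smul_eq_mul, mul_one]
  rw [h', map_smul, hsmul]
  rfl

namespace IsDualBasis

variable {n : ℕ} {e : Fin n → U} {e' : Fin n → B.RightDual}

theorem sum_t_mul (h : IsDualBasis e e') (u : U) : ∑ i, E.t (op (e' i u)) * e i = u :=
  (h u).symm

theorem sum_mul_apply (h : IsDualBasis e e') (φ : B.RightDual) (u : U) :
    ∑ i, φ (e i) * e' i u = φ u := by
  conv_rhs => rw [← h.sum_t_mul u, map_sum]
  exact Finset.sum_congr rfl fun i _ => (RightDual.map_t_mul φ _ _).symm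

end IsDualBasis

/-! ## The actions of the base algebra on the right dual -/

namespace RightDual

@[simp] theorem mul_t_apply (φ : B.RightDual) (a : A) (u : U) :
    (φ * B.dualAeRing.t (op a)) u = a * φ u := mul_tFun a φ u

@[simp] theorem mul_s_apply (φ : B.RightDual) (a : A) (u : U) :
    (φ * B.dualAeRing.s a) u = φ (u * E.t (op a)) := mul_sFun a φ u

@[simp] theorem t_mul_apply (φ : B.RightDual) (a : A) (u : U) :
    (B.dualAeRing.t (op a) * φ) u = φ (E.s a * u) := tFun_mul a φ u

@[simp] theorem s_mul_apply (φ : B.RightDual) (a : A) (u : U) :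
    (B.dualAeRing.s a * φ) u = φ (u * E.s a) := sFun_mul a φ u

@[simp] theorem sum_apply {ι : Type*} (s : Finset ι) (f : ι → B.RightDual) (u : U) :
    (∑ i ∈ s, f i) u = ∑ i ∈ s, f i u := by
  have h := LinearMap.congr_fun (map_sum (eval B) f s) u
  rwa [LinearMap.sum_apply] at h

end RightDual

/-- The action `▶` on the dual multiplies values from the left, so this is `φ` applied to the dual
basis expansion. It says that the `eⁱ`, with evaluation at the `eᵢ` as coordinates, form a dual
basis of `▶U^*`. -/
theorem IsDualBasis.sum_inner_left {n : ℕ} {e : Fin n → U} {e' : Fin n → B.RightDual}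
    (h : IsDualBasis e e') (φ : B.RightDual) :
    ∑ i, B.dualAeRing.inner.left (φ (e i)) (e' i) = φ := by
  ext u
  simp [h.sum_mul_apply]

@[simp] theorem rmulAct_apply (v : U) (φ : B.RightDual) (u : U) :
    B.rmulAct v φ u = φ (u * v) := rfl

@[simp] theorem coproductPairing_tmul (u v : U) (φ ψ : B.RightDual) :
    B.coproductPairing u v
      (BalTensor.tmul B.dualAeRing.inner.right B.dualAeRing.inner.left φ ψ) =
      φ (u * E.t (op (ψ v))) :=
  BalTensor.lift_tmul _ _ _ _

@[simp] theorem translationPairing_tmul (u v : U) (φ ψ : B.RightDual) :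
    B.translationPairing u v
      (BalTensor.tmul B.dualAeRing.inner.left B.dualAeRing.outer.right φ ψ) =
      ψ (E.s (φ u) * v) :=
  BalTensor.lift_tmul _ _ _ _

/-! ## Tensor products with the finitely generated projective module `▶U^*` -/

/-- An element of `M ⊗_A ▶U^*` is determined by its contractions with a dual basis. -/
theorem IsDualBasis.eq_sum_tmul {M : Type*} [AddCommGroup M] [Module k M]
    {r : A → Module.End k M} {n : ℕ} {e : Fin n → U} {e' : Fin n → B.RightDual}
    (h : IsDualBasis e e') (κ : Fin n → BalTensor r B.dualAeRing.inner.left →ₗ[k] M)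
    (hκ : ∀ i m ψ, κ i (BalTensor.tmul r B.dualAeRing.inner.left m ψ) = r (ψ (e i)) m)
    (x : BalTensor r B.dualAeRing.inner.left) :
    x = ∑ i, BalTensor.tmul r B.dualAeRing.inner.left (κ i x) (e' i) := by
  have key : (LinearMap.id : BalTensor r B.dualAeRing.inner.left →ₗ[k] _) =
      ∑ i, ((BalTensor.tmul r B.dualAeRing.inner.left).flip (e' i)).comp (κ i) :=
    BalTensor.hom_ext (fun m ψ => by
      simp only [LinearMap.id_apply, LinearMap.sum_apply, LinearMap.comp_apply, hκ,
        LinearMap.flip_apply, BalTensor.balanced]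
      -- The scalars `ψ(eᵢ)` have been moved across the tensor sign onto the `eⁱ`, so the second
      -- factors add up to `ψ`.
      rw [← map_sum, h.sum_inner_left])
  have := LinearMap.congr_fun key x
  simpa only [LinearMap.id_apply, LinearMap.sum_apply, LinearMap.comp_apply,
    LinearMap.flip_apply] using this

/-- The map `φ ⊗ ψ ↦ φ ◀ ψ(v)` on `U^*_◀ ⊗_A ▶U^*`. -/
def contractSnd (v : U) : B.dualAeRing.inner.Sq →ₗ[k] B.RightDual :=
  BalTensor.lift
    (LinearMap.mk₂ k (fun φ ψ : B.RightDual => B.dualAeRing.inner.right (ψ v) φ)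
      (fun _ _ _ => by simp only [map_add]) (fun _ _ _ => by simp only [map_smul])
      (fun _ _ _ => by simp only [RightDual.add_apply, map_add, LinearMap.add_apply])
      (fun _ _ _ => by simp only [RightDual.smul_apply, map_smul, LinearMap.smul_apply]))
    (fun a φ ψ => by ext u; simp [mul_assoc])

theorem contractSnd_tmul (v : U) (φ ψ : B.RightDual) :
    contractSnd v (BalTensor.tmul B.dualAeRing.inner.right B.dualAeRing.inner.left φ ψ) =
      B.dualAeRing.inner.right (ψ v) φ :=
  BalTensor.lift_tmul _ _ _ _

theorem contractSnd_apply (u v : U) (x : B.dualAeRing.inner.Sq) :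
    contractSnd v x u = B.coproductPairing u v x := by
  have h : ((RightDual.eval B).flip u).comp (contractSnd v) = B.coproductPairing u v :=
    BalTensor.hom_ext (fun φ ψ => by simp [contractSnd_tmul])
  exact LinearMap.congr_fun h x

/-- The map `φ ⊗ ψ ↦ ψ ◁ φ(u)` on `▶U^* ⊗_{Aᵒᵖ} U^*_◁`. -/
def contractFst (u : U) : B.dualAeRing.OpTensor →ₗ[k] B.RightDual :=
  BalTensor.lift
    (LinearMap.mk₂ k (fun φ ψ : B.RightDual => B.dualAeRing.outer.right (φ u) ψ)
      (fun _ _ _ => by simp only [RightDual.add_apply, map_add, LinearMap.add_apply])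
      (fun _ _ _ => by simp only [RightDual.smul_apply, map_smul, LinearMap.smul_apply])
      (fun _ _ _ => by simp only [map_add]) (fun _ _ _ => by simp only [map_smul]))
    (fun a φ ψ => by ext v; simp [mul_assoc])

theorem contractFst_tmul (u : U) (φ ψ : B.RightDual) :
    contractFst u (BalTensor.tmul B.dualAeRing.inner.left B.dualAeRing.outer.right φ ψ) =
      B.dualAeRing.outer.right (φ u) ψ :=
  BalTensor.lift_tmul _ _ _ _

theorem contractFst_apply (u v : U) (x : B.dualAeRing.OpTensor) :
    contractFst u x v = B.translationPairing u v x := by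
  have h : ((RightDual.eval B).flip v).comp (contractFst u) = B.translationPairing u v :=
    BalTensor.hom_ext (fun φ ψ => by simp [contractFst_tmul])
  exact LinearMap.congr_fun h x

/-- The pairings at all `u` determine the contraction of the second factor with `v`, and the
contractions with a dual basis recover the tensor. This is the source of every uniqueness statement
for the coproduct. -/
theorem coproductPairing_ext (hU : E.RactFGProjective) {x y : B.dualAeRing.inner.Sq}
    (h : ∀ u v, B.coproductPairing u v x = B.coproductPairing u v y) : x = y := by
  obtain ⟨n, e, e', he⟩ := B.exists_isDualBasis hU
  have hc : ∀ v, contractSnd v x = contractSnd v y := fun v => by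
    ext u; rw [contractSnd_apply, contractSnd_apply, h]
  rw [he.eq_sum_tmul (fun i => contractSnd (e i)) (fun i => contractSnd_tmul (e i)) x,
    he.eq_sum_tmul (fun i => contractSnd (e i)) (fun i => contractSnd_tmul (e i)) y]
  simp only [hc]

/-- The mirror image of `coproductPairing_ext`: here the factor `▶U^*` with the dual basis stands on
the left, so the first factor is the one contracted. -/
theorem translationPairing_ext (hU : E.RactFGProjective) {x y : B.dualAeRing.OpTensor}
    (h : ∀ u v, B.translationPairing u v x = B.translationPairing u v y) : x = y := by
  obtain ⟨n, e, e', he⟩ := B.exists_isDualBasis hU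
  have key : (LinearMap.id : B.dualAeRing.OpTensor →ₗ[k] _) =
      ∑ i, (BalTensor.tmul B.dualAeRing.inner.left B.dualAeRing.outer.right (e' i)).comp
        (contractFst (e i)) :=
    BalTensor.hom_ext (fun φ ψ => by
      simp only [LinearMap.id_apply, LinearMap.sum_apply, LinearMap.comp_apply,
        contractFst_tmul, ← BalTensor.balanced]
      rw [← LinearMap.sum_apply, ← map_sum, he.sum_inner_left])
  have hc : ∀ u, contractFst u x = contractFst u y := fun u => by
    ext v; rw [contractFst_apply, contractFst_apply, h]
  have hx := LinearMap.congr_fun key x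
  have hy := LinearMap.congr_fun key y
  simp only [LinearMap.id_apply, LinearMap.sum_apply, LinearMap.comp_apply] at hx hy
  rw [hx, hy]
  simp only [hc]

/-! ### Base actions under the pairing, and separation on the tensor cube -/

@[simp] theorem coproductPairing_sqLeft (a : A) (u v : U) (x : B.dualAeRing.inner.Sq) :
    B.coproductPairing u v (B.dualAeRing.inner.sqLeft a x) = a * B.coproductPairing u v x := by
  have h : (B.coproductPairing u v).comp (B.dualAeRing.inner.sqLeft a) =
      (LinearMap.mulLeft k a).comp (B.coproductPairing u v) :=
    BalTensor.hom_ext (fun φ ψ => by simp [BimoduleStr.sqLeft])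
  exact LinearMap.congr_fun h x

@[simp] theorem coproductPairing_sqRight (a : A) (u v : U) (x : B.dualAeRing.inner.Sq) :
    B.coproductPairing u v (B.dualAeRing.inner.sqRight a x) =
      B.coproductPairing u (v * E.t (op a)) x := by
  have h : (B.coproductPairing u v).comp (B.dualAeRing.inner.sqRight a) =
      B.coproductPairing u (v * E.t (op a)) :=
    BalTensor.hom_ext (fun φ ψ => by simp [BimoduleStr.sqRight])
  exact LinearMap.congr_fun h x

@[simp] theorem coproductPairing_innerTakFst (a : A) (u v : U) (x : B.dualAeRing.inner.Sq) :
    B.coproductPairing u v (B.dualAeRing.innerTakFst a x) =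
      B.coproductPairing (u * E.s a) v x := by
  have h : (B.coproductPairing u v).comp (B.dualAeRing.innerTakFst a) =
      B.coproductPairing (u * E.s a) v :=
    BalTensor.hom_ext (fun φ ψ => by simp [AeRing.innerTakFst_tmul, mul_assoc, E.comm])
  exact LinearMap.congr_fun h x

@[simp] theorem coproductPairing_innerTakSnd (a : A) (u v : U) (x : B.dualAeRing.inner.Sq) :
    B.coproductPairing u v (B.dualAeRing.innerTakSnd a x) =
      B.coproductPairing u (E.s a * v) x := by
  have h : (B.coproductPairing u v).comp (B.dualAeRing.innerTakSnd a) =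
      B.coproductPairing u (E.s a * v) :=
    BalTensor.hom_ext (fun φ ψ => by simp [AeRing.innerTakSnd_tmul])
  exact LinearMap.congr_fun h x

/-- The map `x ⊗ χ ↦ x ◀ χ(w)` on the tensor cube of `U^*`. -/
def contractThird (w : U) : B.dualAeRing.inner.Cube →ₗ[k] B.dualAeRing.inner.Sq :=
  BalTensor.lift
    (LinearMap.mk₂ k
      (fun (x : B.dualAeRing.inner.Sq) (χ : B.RightDual) => B.dualAeRing.inner.sqRight (χ w) x)
      (fun _ _ _ => by simp only [map_add]) (fun _ _ _ => by simp only [map_smul])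
      (fun x χ χ' => by
        have h : B.dualAeRing.inner.sqRight ((χ + χ') w) =
            B.dualAeRing.inner.sqRight (χ w) + B.dualAeRing.inner.sqRight (χ' w) :=
          BalTensor.hom_ext (fun φ ψ => by simp [BimoduleStr.sqRight])
        exact LinearMap.congr_fun h x)
      (fun c x χ => by
        have h : B.dualAeRing.inner.sqRight ((c • χ) w) =
            c • B.dualAeRing.inner.sqRight (χ w) :=
          BalTensor.hom_ext (fun φ ψ => by simp [BimoduleStr.sqRight])
        exact LinearMap.congr_fun h x))
    (fun a x χ => by
      have h : (B.dualAeRing.inner.sqRight (χ w)).comp (B.dualAeRing.inner.sqRight a) =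
          B.dualAeRing.inner.sqRight (B.dualAeRing.inner.left a χ w) :=
        BalTensor.hom_ext (fun φ ψ => by simp [BimoduleStr.sqRight, mul_assoc])
      exact LinearMap.congr_fun h x)

theorem contractThird_tmul (w : U) (x : B.dualAeRing.inner.Sq) (χ : B.RightDual) :
    contractThird w
      (BalTensor.tmul B.dualAeRing.inner.sqRight B.dualAeRing.inner.left x χ) =
      B.dualAeRing.inner.sqRight (χ w) x :=
  BalTensor.lift_tmul _ _ _ _

/-- The last factor is again `▶U^*`, so contracting it with a dual basis reduces the claim to
`coproductPairing_ext`. -/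
theorem cube_ext (hU : E.RactFGProjective) {x y : B.dualAeRing.inner.Cube}
    (h : ∀ u v w, B.coproductPairing u v (contractThird w x) =
      B.coproductPairing u v (contractThird w y)) : x = y := by
  obtain ⟨n, e, e', he⟩ := B.exists_isDualBasis hU
  have hc : ∀ w, contractThird w x = contractThird w y := fun w =>
    coproductPairing_ext hU fun u v => h u v w
  rw [he.eq_sum_tmul (fun i => contractThird (e i)) (fun i => contractThird_tmul (e i)) x,
    he.eq_sum_tmul (fun i => contractThird (e i)) (fun i => contractThird_tmul (e i)) y]
  simp only [hc]

/-! ## The right action of the dual on the left bialgebroid -/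

/-- The map `u ⊗ v ↦ φ(u) ▷ v` on `U_◁ ⊗_A ▷U`. -/
def evalFst (φ : B.RightDual) : E.outer.Sq →ₗ[k] U :=
  BalTensor.lift ((LinearMap.mul k U).comp (E.s.toLinearMap.comp (RightDual.eval B φ)))
    (fun a u v => by simp [RightDual.map_t_mul, mul_assoc])

theorem evalFst_tmul (φ : B.RightDual) (u v : U) :
    evalFst φ (BalTensor.tmul E.outer.right E.outer.left u v) = E.s (φ u) * v :=
  BalTensor.lift_tmul _ _ _ _

/-- The right action `φ(u₍₁₎) ▷ u₍₂₎` of `φ` on `u`. -/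
def hit (u : U) : B.RightDual →ₗ[k] U where
  toFun φ := evalFst φ (B.comul u)
  map_add' φ ψ := by
    have h : evalFst (φ + ψ) = evalFst φ + evalFst ψ :=
      BalTensor.hom_ext (fun u v => by simp [evalFst_tmul, add_mul])
    rw [h, LinearMap.add_apply]
  map_smul' c φ := by
    have h : evalFst (c • φ) = c • evalFst φ :=
      BalTensor.hom_ext (fun u v => by simp [evalFst_tmul])
    rw [h, LinearMap.smul_apply, RingHom.id_apply]

theorem hit_apply (u : U) (φ : B.RightDual) : hit u φ = evalFst φ (B.comul u) := rfl

/-- The convolution pairing factors through `evalFst`. Left multiplication by `φ` on the dual is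
thus the transpose of the action of `φ` on `U`, which removes convolutions from later computations.
-/
theorem mul_apply_eq_hit (φ ψ : B.RightDual) (u : U) : (φ * ψ) u = ψ (hit u φ) := by
  have h : RightDual.convol φ ψ = (RightDual.eval B ψ).comp (evalFst φ) :=
    BalTensor.hom_ext (fun u v => by simp [evalFst_tmul])
  rw [RightDual.mul_apply, h]
  rfl

theorem hit_mul_t (u : U) (φ : B.RightDual) (a : A) :
    hit (u * E.t (op a)) φ = hit u φ * E.t (op a) := by
  obtain ⟨x, hx⟩ := BalTensor.mk_surjective (B.comul u)
  rw [hit_apply, hit_apply, B.comul_mul_t_eq u a x hx.symm, ← hx]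
  clear hx
  induction x with
  | zero => simp
  | add x y hx hy => simp only [add_mul, map_add, hx, hy]
  | tmul p q =>
    rw [Algebra.TensorProduct.tmul_mul_tmul, mul_one]
    simp only [AeRing.outerMk, BalTensor.mk_tmul, evalFst_tmul, mul_assoc]

/-- This is the Takeuchi condition on `Δ(u)`: the factor `s(a)` to the right of `u₍₂₎` becomes
`t(a)` to the right of `u₍₁₎`, where `φ` absorbs it. -/
theorem hit_mul_s (u : U) (φ : B.RightDual) (a : A) :
    hit u φ * E.s a = hit u (B.dualAeRing.inner.right a φ) := by
  have h₁ : (LinearMap.mulRight k (E.s a)).comp (evalFst φ) =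
      (evalFst φ).comp (E.outerTakSnd a) :=
    BalTensor.hom_ext (fun p q => by simp [AeRing.outerTakSnd_tmul, evalFst_tmul, mul_assoc])
  have h₂ : evalFst (B.dualAeRing.inner.right a φ) = (evalFst φ).comp (E.outerTakFst a) :=
    BalTensor.hom_ext (fun p q => by simp [AeRing.outerTakFst_tmul, evalFst_tmul])
  have h₃ := LinearMap.congr_fun h₁ (B.comul u)
  rw [hit_apply, hit_apply, h₂, LinearMap.comp_apply, B.takeuchi]
  exact h₃

theorem exists_comul_eq_sum (B : LeftBialgebroid E) (u : U) :
    ∃ S : Finset (U × U), B.comul u = E.outerMk (∑ p ∈ S, p.1 ⊗ₜ[k] p.2) := by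
  obtain ⟨x, hx⟩ := BalTensor.mk_surjective (B.comul u)
  obtain ⟨S, hS⟩ := TensorProduct.exists_finset x
  exact ⟨S, by rw [← hS]; exact hx.symm⟩

theorem hit_eq_sum {u : U} {ι : Type*} {S : Finset ι} {p q : ι → U}
    (h : B.comul u = E.outerMk (∑ i ∈ S, p i ⊗ₜ[k] q i)) (φ : B.RightDual) :
    hit u φ = ∑ i ∈ S, E.s (φ (p i)) * q i := by
  simp only [hit_apply, h, map_sum, AeRing.outerMk, BalTensor.mk_tmul, evalFst_tmul]

/-- The map `φ ⊗ ψ ↦ (φ(u₍₁₎) ▷ u₍₂₎) (ψ(v₍₁₎) ▷ v₍₂₎)` on `U^*_◀ ⊗_A ▶U^*`. -/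
def hitMul (u v : U) : B.dualAeRing.inner.Sq →ₗ[k] U :=
  BalTensor.lift ((LinearMap.mul k U).compl₁₂ (hit u) (hit v)) (fun a φ ψ => by
    -- Both sides carry `s(a)` in the middle: on the left it comes from the Takeuchi condition, and
    -- on the right from `(a ▶ ψ)(v₍₁₎) = a ψ(v₍₁₎)`.
    simp only [LinearMap.compl₁₂_apply, LinearMap.mul_apply', ← hit_mul_s, mul_assoc]
    congr 1
    obtain ⟨S, hS⟩ := B.exists_comul_eq_sum v
    simp [hit_eq_sum hS, Finset.mul_sum, mul_assoc])

theorem hitMul_tmul (u v : U) (φ ψ : B.RightDual) :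
    hitMul u v (BalTensor.tmul B.dualAeRing.inner.right B.dualAeRing.inner.left φ ψ) =
      hit u φ * hit v ψ :=
  BalTensor.lift_tmul _ _ _ _

/-- Only `Δ(v)` is expanded. The resulting factor `s(ψ(v₍₁₎))` is absorbed into the first tensor
factor by `hit_mul_s`, so that the whole tensor enters only through its contractions. -/
theorem hitMul_eq_sum {v : U} {ι : Type*} {S : Finset ι} {p q : ι → U}
    (h : B.comul v = E.outerMk (∑ i ∈ S, p i ⊗ₜ[k] q i)) (u : U)
    (x : B.dualAeRing.inner.Sq) :
    hitMul u v x = ∑ i ∈ S, hit u (contractSnd (p i) x) * q i := by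
  have key : hitMul u v =
      ∑ i ∈ S, ((LinearMap.mul k U).flip (q i)).comp ((hit u).comp (contractSnd (B := B) (p i))) :=
    BalTensor.hom_ext (fun φ ψ => by
      rw [hitMul_tmul, hit_eq_sum h, Finset.mul_sum]
      simp only [LinearMap.sum_apply, LinearMap.comp_apply, LinearMap.flip_apply,
        LinearMap.mul_apply', contractSnd_tmul, ← hit_mul_s, mul_assoc])
  simpa only [LinearMap.sum_apply, LinearMap.comp_apply, LinearMap.flip_apply,
    LinearMap.mul_apply'] using
    LinearMap.congr_fun key x

/-- The multiplication of `U` is dual to the coproduct of `U^*`. -/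
theorem hitMul_eq_hit_mul {φ : B.RightDual} {x : B.dualAeRing.inner.Sq}
    (hx : ∀ u v, B.coproductPairing u v x = φ (u * v)) (u v : U) :
    hitMul u v x = hit (u * v) φ := by
  obtain ⟨S, hS⟩ := B.exists_comul_eq_sum u
  obtain ⟨T, hT⟩ := B.exists_comul_eq_sum v
  have hST : B.comul (u * v) =
      E.outerMk (∑ i ∈ S ×ˢ T, (i.1.1 * i.2.1) ⊗ₜ[k] (i.1.2 * i.2.2)) := by
    rw [B.comul_mul u v _ _ hS hT, Finset.sum_mul_sum, Finset.sum_product]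
    simp only [Algebra.TensorProduct.tmul_mul_tmul]
  -- Both sides become sums of `s(φ(u₍₁₎v₍₁₎)) u₍₂₎ v₍₂₎`: contracting `x` with `v₍₁₎` and
  -- evaluating at `u₍₁₎` gives `φ(u₍₁₎v₍₁₎)` by `hx`.
  rw [hitMul_eq_sum hT, hit_eq_sum hST, Finset.sum_product_right]
  refine Finset.sum_congr rfl fun j _ => ?_
  rw [hit_eq_sum hS, Finset.sum_mul]
  refine Finset.sum_congr rfl fun i _ => ?_
  rw [contractSnd_apply, hx, mul_assoc]

/-- For a pure tensor `x = φ ⊗ φ'`, left multiplication by `x` moves to the arguments: `u` and `v`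
are replaced by their images under `φ` and `φ'`, and there `y` pairs as the coproduct of `ψ`.
Nothing is required of `x`. -/
theorem coproductPairing_mul (u v : U) (x y : B.RightDual ⊗[k] B.RightDual) {ψ : B.RightDual}
    (hy : ∀ u v, B.coproductPairing u v (B.dualAeRing.innerMk y) = ψ (u * v)) :
    B.coproductPairing u v (B.dualAeRing.innerMk (x * y)) =
      ψ (hitMul u v (B.dualAeRing.innerMk x)) := by
  induction x with
  | zero => simp
  | add x x' hx hx' => simp only [add_mul, map_add, hx, hx']
  | tmul φ φ' =>
    simp only [AeRing.innerMk, BalTensor.mk_tmul, hitMul_tmul]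
    rw [← hy]
    -- After `hy` has been used, both sides are linear in `y`. The summands of `y` need not satisfy
    -- `hy`, so it has to go before the induction.
    clear hy
    induction y with
    | zero => simp
    | add y y' hy hy' => simp only [mul_add, map_add, hy, hy']
    | tmul χ χ' =>
      rw [Algebra.TensorProduct.tmul_mul_tmul]
      simp [AeRing.innerMk, BalTensor.mk_tmul, mul_apply_eq_hit, hit_mul_t]

/-! ## The right bialgebroid structure on the dual -/

/-- The pairing produces `φ(u · ∑ t(eⁱ(v)) eᵢ)`, and the inner sum is the dual basis expansion of
`v`. This gives existence of the coproduct and, by uniqueness, its formula for every dual basis. -/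
theorem coproductPairing_sum_rmulAct {n : ℕ} {e : Fin n → U} {e' : Fin n → B.RightDual}
    (h : IsDualBasis e e') (φ : B.RightDual) (u v : U) :
    B.coproductPairing u v (∑ i, B.dualAeRing.innerTmul (B.rmulAct (e i) φ) (e' i)) =
      φ (u * v) := by
  simp only [map_sum, AeRing.innerTmul, coproductPairing_tmul, rmulAct_apply, mul_assoc]
  rw [← map_sum, ← Finset.mul_sum, h.sum_t_mul]

theorem exists_coproduct (hU : E.RactFGProjective) (φ : B.RightDual) :
    ∃ x : B.dualAeRing.inner.Sq, ∀ u v, B.coproductPairing u v x = φ (u * v) := by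
  obtain ⟨n, e, e', he⟩ := B.exists_isDualBasis hU
  exact ⟨_, coproductPairing_sum_rmulAct he φ⟩

/-- The coproduct of the right dual, characterised by `φ⁽¹⁾(φ⁽²⁾(v) ▶ u) = φ(u v)`. -/
def dualComul (hU : E.RactFGProjective) : B.RightDual →ₗ[k] B.dualAeRing.inner.Sq where
  toFun φ := (exists_coproduct hU φ).choose
  -- The chosen elements depend linearly on `φ` because they are unique.
  map_add' φ ψ := coproductPairing_ext hU fun u v => by
    rw [map_add, (exists_coproduct hU (φ + ψ)).choose_spec,
      (exists_coproduct hU φ).choose_spec, (exists_coproduct hU ψ).choose_spec]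
    rfl
  map_smul' c φ := coproductPairing_ext hU fun u v => by
    rw [map_smul, (exists_coproduct hU (c • φ)).choose_spec,
      (exists_coproduct hU φ).choose_spec]
    rfl

@[simp] theorem coproductPairing_dualComul (hU : E.RactFGProjective) (φ : B.RightDual)
    (u v : U) : B.coproductPairing u v (dualComul hU φ) = φ (u * v) :=
  (exists_coproduct hU φ).choose_spec u v

theorem dualComul_eq_iff (hU : E.RactFGProjective) (φ : B.RightDual)
    (x : B.dualAeRing.inner.Sq) :
    dualComul hU φ = x ↔ ∀ u v : U, B.coproductPairing u v x = φ (u * v) := by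
  refine ⟨?_, fun h => coproductPairing_ext hU fun u v => by
    rw [h, coproductPairing_dualComul]⟩
  rintro rfl
  exact coproductPairing_dualComul hU φ

/-- The coring data of the right dual. -/
def dualCoringData (B : LeftBialgebroid E) (hU : E.RactFGProjective) :
    CoringData B.dualAeRing.inner where
  comul := dualComul hU
  counit := (RightDual.eval B).flip 1
  comul_left a φ := coproductPairing_ext hU fun u v => by simp
  comul_right a φ := coproductPairing_ext hU fun u v => by simp [mul_assoc]
  counit_left a φ := by simp
  counit_right a φ := by
    have h := RightDual.map_t_mul φ 1 a
    rw [mul_one] at h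
    simp [h]

/-- In the triple pairing, a coproduct in the first factor multiplies the first two arguments;
`contractThird_comulSnd` multiplies the last two. Coassociativity then reads `(uv)w = u(vw)`. -/
theorem contractThird_comulFst (hU : E.RactFGProjective) (u v w : U)
    (x : B.dualAeRing.inner.Sq) :
    B.coproductPairing u v (contractThird w ((B.dualCoringData hU).comulFst x)) =
      B.coproductPairing (u * v) w x := by
  have h : ((B.coproductPairing u v).comp (contractThird w)).comp
      (B.dualCoringData hU).comulFst = B.coproductPairing (u * v) w :=
    BalTensor.hom_ext (fun φ ψ => by
      simp [CoringData.comulFst, contractThird_tmul, dualCoringData, mul_assoc])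
  exact LinearMap.congr_fun h x

theorem contractThird_consCube (φ : B.RightDual) (u v w : U) (x : B.dualAeRing.inner.Sq) :
    B.coproductPairing u v (contractThird w (B.dualAeRing.inner.consCube φ x)) =
      φ (u * E.t (op (B.coproductPairing v w x))) := by
  have h : ((B.coproductPairing u v).comp (contractThird w)).comp
      (B.dualAeRing.inner.consCube φ) =
      (RightDual.eval B φ).comp ((E.inner.left.flip u).comp (B.coproductPairing v w)) :=
    BalTensor.hom_ext (fun ψ χ => by simp [contractThird_tmul])
  exact LinearMap.congr_fun h x

theorem contractThird_comulSnd (hU : E.RactFGProjective) (u v w : U)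
    (x : B.dualAeRing.inner.Sq) :
    B.coproductPairing u v (contractThird w ((B.dualCoringData hU).comulSnd x)) =
      B.coproductPairing u (v * w) x := by
  have h : ((B.coproductPairing u v).comp (contractThird w)).comp
      (B.dualCoringData hU).comulSnd = B.coproductPairing u (v * w) :=
    BalTensor.hom_ext (fun φ ψ => by
      simp [CoringData.comulSnd, contractThird_consCube, dualCoringData])
  exact LinearMap.congr_fun h x

/-- The coring structure of the right dual. -/
def dualCoring (B : LeftBialgebroid E) (hU : E.RactFGProjective) :
    Coring B.dualAeRing.inner where
  toCoringData := B.dualCoringData hU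
  coassoc φ := cube_ext hU fun u v w => by
    rw [contractThird_comulFst, contractThird_comulSnd]
    simp [dualCoringData, mul_assoc]
  counit_fst φ := by
    ext v
    -- Since `φ(t(ψ(v))) = φ(1) ψ(v)`, applying the counit to the first factor amounts to pairing
    -- with `1` there.
    have h : ((RightDual.eval B).flip v).comp (B.dualCoringData hU).counitFst =
        B.coproductPairing 1 v :=
      BalTensor.hom_ext (fun φ ψ => by
        have h := RightDual.map_t_mul φ 1 (ψ v)
        rw [mul_one] at h
        simp [CoringData.counitFst_tmul, dualCoringData, h])
    have h' := LinearMap.congr_fun h (dualComul hU φ)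
    rw [coproductPairing_dualComul, one_mul] at h'
    exact h'
  counit_snd φ := by
    ext u
    have h : ((RightDual.eval B).flip u).comp (B.dualCoringData hU).counitSnd =
        B.coproductPairing u 1 :=
      BalTensor.hom_ext (fun φ ψ => by simp [CoringData.counitSnd_tmul, dualCoringData])
    have h' := LinearMap.congr_fun h (dualComul hU φ)
    rw [coproductPairing_dualComul, mul_one] at h'
    exact h'

theorem mul_apply_one (φ ψ : B.RightDual) : (φ * ψ) 1 = ψ (E.s (φ 1)) := by
  rw [RightDual.mul_apply, B.comul_one, AeRing.outerTmul, RightDual.convol_tmul, mul_one]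

/-- The right bialgebroid structure of the right dual. -/
def dualRightBialgebroid (B : LeftBialgebroid E) (hU : E.RactFGProjective) :
    RightBialgebroid B.dualAeRing where
  toCoring := B.dualCoring hU
  takeuchi a φ := coproductPairing_ext hU fun u v => by
    simp [dualCoring, dualCoringData, mul_assoc]
  -- The unit of the dual is `ε`, so the claim is the counit axiom `ε(u t(ε(v))) = ε(uv)`.
  comul_one := (dualComul_eq_iff hU _ _).2 fun u v => by
    simp [AeRing.innerTmul, RightDual.one_apply, ← B.counit_mul_t]
  comul_mul φ ψ x y hx hy := by
    refine (dualComul_eq_iff hU _ _).2 fun u v => ?_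
    -- Both sides are `ψ` evaluated at the action of `φ` on `uv`.
    rw [coproductPairing_mul u v x y ((dualComul_eq_iff hU ψ _).1 hy),
      hitMul_eq_hit_mul ((dualComul_eq_iff hU φ _).1 hx), mul_apply_eq_hit]
  counit_one := B.counit_one
  counit_mul_s φ ψ := by
    change (φ * ψ) 1 = (B.dualAeRing.s (φ 1) * ψ) 1
    rw [mul_apply_one, RightDual.s_mul_apply, one_mul]
  counit_mul_t φ ψ := by
    change (φ * ψ) 1 = (B.dualAeRing.t (op (φ 1)) * ψ) 1
    rw [mul_apply_one, RightDual.t_mul_apply, mul_one]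

/-! ## The Hopf-Galois map of the dual -/

/-- The function `u ⊗ v ↦ ψ(φ(u) ▷ v)` on `U_◁ ⊗_A ▷U` attached to an element of
`▶U^* ⊗_{Aᵒᵖ} U^*_◁`. -/
def opTensorPairing : B.dualAeRing.OpTensor →ₗ[k] E.outer.Sq →ₗ[k] A :=
  BalTensor.lift
    (LinearMap.mk₂ k RightDual.convol RightDual.convol_add_left RightDual.convol_smul_left
      RightDual.convol_add_right RightDual.convol_smul_right)
    (fun a φ ψ => BalTensor.hom_ext (fun u v => by simp [mul_assoc]))

theorem opTensorPairing_tmul (φ ψ : B.RightDual) :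
    opTensorPairing (BalTensor.tmul B.dualAeRing.inner.left B.dualAeRing.outer.right φ ψ) =
      RightDual.convol φ ψ :=
  BalTensor.lift_tmul _ _ _ _

theorem opTensorPairing_apply_tmul (x : B.dualAeRing.OpTensor) (u v : U) :
    opTensorPairing x (BalTensor.tmul E.outer.right E.outer.left u v) =
      B.translationPairing u v x := by
  have h : opTensorPairing.flip (BalTensor.tmul E.outer.right E.outer.left u v) =
      B.translationPairing u v :=
    BalTensor.hom_ext (fun φ ψ => by simp [opTensorPairing_tmul])
  exact LinearMap.congr_fun h x

/-- Balancing of `f` gives `f(eᵢ ⊗ eⁱ(u) ▷ v) = f(eᵢ ◁ eⁱ(u) ⊗ v)`, and the first entries sum to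
`u`. This supplies preimages under the Galois map of the dual. -/
theorem translationPairing_sum_tmul {n : ℕ} {e : Fin n → U} {e' : Fin n → B.RightDual}
    (h : IsDualBasis e e') (f : E.outer.Sq →ₗ[k] A) (g : U → B.RightDual)
    (hg : ∀ u v, g u v = f (E.outerTmul u v)) (u v : U) :
    B.translationPairing u v (∑ i, B.dualAeRing.opTmul (e' i) (g (e i))) =
      f (E.outerTmul u v) := by
  simp only [map_sum, AeRing.opTmul, translationPairing_tmul, hg, AeRing.outerTmul]
  conv_rhs => rw [h u]
  simp only [map_sum, LinearMap.sum_apply, BalTensor.balanced, AeRing.outer_left]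

theorem innerMulFst_mul (φ χ : B.RightDual) (z : B.dualAeRing.inner.Sq) :
    B.dualAeRing.innerMulFst z (φ * χ) =
      B.dualAeRing.innerMulFst (B.dualAeRing.innerMulFst z χ) φ := by
  have h : B.dualAeRing.innerMulFst.flip (φ * χ) =
      (B.dualAeRing.innerMulFst.flip φ).comp (B.dualAeRing.innerMulFst.flip χ) :=
    BalTensor.hom_ext (fun p q => by
      have h₁ := B.dualAeRing.innerMulFst_tmul p q (φ * χ)
      have h₂ := B.dualAeRing.innerMulFst_tmul p q χ
      have h₃ := B.dualAeRing.innerMulFst_tmul (χ * p) q φ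
      simp only [AeRing.innerTmul] at h₁ h₂ h₃
      simp [h₁, h₂, h₃, mul_assoc])
  exact LinearMap.congr_fun h z

theorem coproductPairing_innerMulFst (φ : B.RightDual) (u v : U)
    (z : B.dualAeRing.inner.Sq) :
    B.coproductPairing u v (B.dualAeRing.innerMulFst z φ) =
      B.coproductPairing (hit u φ) v z := by
  have h : (B.coproductPairing u v).comp (B.dualAeRing.innerMulFst.flip φ) =
      B.coproductPairing (hit u φ) v :=
    BalTensor.hom_ext (fun p q => by
      have h := B.dualAeRing.innerMulFst_tmul p q φ
      simp only [AeRing.innerTmul] at h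
      simp [h, mul_apply_eq_hit, hit_mul_t])
  exact LinearMap.congr_fun h z

theorem dual_galois_tmul (hU : E.RactFGProjective) (φ ψ : B.RightDual) :
    (B.dualRightBialgebroid hU).galois
      (BalTensor.tmul B.dualAeRing.inner.left B.dualAeRing.outer.right φ ψ) =
      B.dualAeRing.innerMulFst (dualComul hU ψ) φ :=
  BalTensor.lift_tmul _ _ _ _

/-- The Hopf-Galois map of `U^*` is dual to the one of `U`. -/
theorem coproductPairing_galois (hU : E.RactFGProjective) (x : B.dualAeRing.OpTensor)
    (u v : U) :
    B.coproductPairing u v ((B.dualRightBialgebroid hU).galois x) =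
      opTensorPairing x (B.galois (E.opTmul u v)) := by
  have h : (B.coproductPairing u v).comp (B.dualRightBialgebroid hU).galois =
      opTensorPairing.flip (B.galois (E.opTmul u v)) :=
    BalTensor.hom_ext (fun φ ψ => by
      -- For `x = φ ⊗ ψ`, the left side is `ψ` at the product of `φ(u₍₁₎) ▷ u₍₂₎` with `v`, which is
      -- the convolution pairing of `φ` and `ψ` at `u₍₁₎ ⊗ u₍₂₎v`.
      rw [LinearMap.comp_apply, dual_galois_tmul, coproductPairing_innerMulFst,
        coproductPairing_dualComul, LinearMap.flip_apply, opTensorPairing_tmul, galois_tmul]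
      obtain ⟨S, hS⟩ := B.exists_comul_eq_sum u
      rw [hit_eq_sum hS, hS]
      simp only [map_sum, LinearMap.sum_apply, Finset.sum_mul, AeRing.outerMk,
        BalTensor.mk_tmul]
      refine Finset.sum_congr rfl fun i _ => ?_
      have h := E.outerMulSnd_tmul i.1 i.2 v
      simp only [AeRing.outerTmul] at h
      rw [h, RightDual.convol_tmul, mul_assoc])
  exact LinearMap.congr_fun h x

/-- `Δ(u ◁ a) = u₍₁₎ ⊗ (u₍₂₎ ◁ a)`, and acting by `t(a)` from the left commutes with multiplying the
second factor from the right. -/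
theorem galois_opTakFst (a : A) (z : E.OpTensor) :
    B.galois (E.opTakFst a z) = E.outer.sqRight a (B.galois z) := by
  have key : ∀ (x : E.outer.Sq) (y : U),
      E.outerMulSnd (E.outer.sqRight a x) y = E.outer.sqRight a (E.outerMulSnd x y) := by
    intro x y
    have e : (E.outerMulSnd.flip y).comp (E.outer.sqRight a) =
        (E.outer.sqRight a).comp (E.outerMulSnd.flip y) :=
      BalTensor.hom_ext (fun p q => by
        have h₁ := E.outerMulSnd_tmul p (E.t (op a) * q) y
        have h₂ := E.outerMulSnd_tmul p q y
        simp only [AeRing.outerTmul] at h₁ h₂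
        simp [BimoduleStr.sqRight, h₁, h₂, mul_assoc])
    exact LinearMap.congr_fun e x
  have e₁ : B.galois.comp (E.opTakFst a) = (E.outer.sqRight a).comp B.galois :=
    BalTensor.hom_ext (fun x y => by
      have h₁ := E.opTakFst_tmul a x y
      have h₂ := B.comul_right a x
      simp only [AeRing.opTmul] at h₁
      simp only [LinearMap.comp_apply, h₁, galois_tmul, h₂, key])
  exact LinearMap.congr_fun e₁ z

/-- The map `u ⊗ v ↦ φ(ψ(v) ▶ u)` on `▶U ⊗_{Aᵒᵖ} U_◁` attached to `φ ⊗ ψ`. -/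
def innerPairing : B.dualAeRing.inner.Sq →ₗ[k] E.OpTensor →ₗ[k] A :=
  BalTensor.lift
    (LinearMap.mk₂ k
      (fun φ ψ : B.RightDual => BalTensor.lift
        ((E.inner.left.flip.compl₂ (RightDual.eval B ψ)).compr₂ (RightDual.eval B φ))
        (fun a u v => by simp [RightDual.map_t_mul, mul_assoc]))
      (fun _ _ _ => BalTensor.hom_ext (fun u v => by simp))
      (fun _ _ _ => BalTensor.hom_ext (fun u v => by simp))
      (fun _ _ _ => BalTensor.hom_ext (fun u v => by simp))
      (fun _ _ _ => BalTensor.hom_ext (fun u v => by simp)))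
    (fun a φ ψ => BalTensor.hom_ext (fun u v => by simp [mul_assoc]))

theorem innerPairing_apply_tmul (x : B.dualAeRing.inner.Sq) (u v : U) :
    innerPairing x (BalTensor.tmul E.inner.left E.outer.right u v) =
      B.coproductPairing u v x := by
  have h : innerPairing.flip (BalTensor.tmul E.inner.left E.outer.right u v) =
      B.coproductPairing u v :=
    BalTensor.hom_ext (fun φ ψ => by simp [innerPairing])
  exact LinearMap.congr_fun h x

theorem innerPairing_opTakFst (x : B.dualAeRing.inner.Sq) (a : A) (z : E.OpTensor) :
    innerPairing x (E.opTakFst a z) = innerPairing x z * a := by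
  have h : (innerPairing x).comp (E.opTakFst a) =
      (LinearMap.mulRight k a).comp (innerPairing x) :=
    BalTensor.hom_ext (fun u v => by
      have h := E.opTakFst_tmul a u v
      simp only [AeRing.opTmul, AeRing.outer_right] at h
      simp only [LinearMap.comp_apply, h, innerPairing_apply_tmul, LinearMap.mulRight_apply,
        ← contractSnd_apply, RightDual.map_t_mul])
  exact LinearMap.congr_fun h z

/-! ### Bijectivity and inverse of the Hopf-Galois map of the dual -/

namespace IsLeftHopf

variable (hB : B.IsLeftHopf)

/-- The Hopf-Galois map of `U` as a linear equivalence. -/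
def galoisEquiv : E.OpTensor ≃ₗ[k] E.outer.Sq := LinearEquiv.ofBijective B.galois hB

@[simp] theorem galoisEquiv_apply (z : E.OpTensor) : hB.galoisEquiv z = B.galois z := rfl

/-- The function `u ⊗ v ↦ x(u₊ ⊗ u₋ v)`. -/
def pullback (x : B.dualAeRing.inner.Sq) : E.outer.Sq →ₗ[k] A :=
  (innerPairing x).comp hB.galoisEquiv.symm.toLinearMap

theorem pullback_galois (x : B.dualAeRing.inner.Sq) (z : E.OpTensor) :
    hB.pullback x (B.galois z) = innerPairing x z := by
  rw [pullback, LinearMap.comp_apply, ← hB.galoisEquiv_apply, LinearEquiv.coe_coe,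
    LinearEquiv.symm_apply_apply]

/-- Surjectivity of the Galois map transports right linearity from `innerPairing_opTakFst`.
Consequently each slice `v ↦ pullback(u ⊗ v)` is an element of `U^*`. -/
theorem pullback_sqRight (x : B.dualAeRing.inner.Sq) (a : A) (z : E.outer.Sq) :
    hB.pullback x (E.outer.sqRight a z) = hB.pullback x z * a := by
  obtain ⟨z, rfl⟩ := hB.2 z
  rw [← galois_opTakFst, pullback_galois, pullback_galois, innerPairing_opTakFst]

/-- By `coproductPairing_galois` the equation on the left says that the function of `x`, composed
with the Galois map of `U`, is the function of `y`; that map is invertible, so it can be moved to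
the other side. -/
theorem galois_eq_iff (hU : E.RactFGProjective) (x : B.dualAeRing.OpTensor)
    (y : B.dualAeRing.inner.Sq) :
    (B.dualRightBialgebroid hU).galois x = y ↔
      ∀ u v, B.translationPairing u v x = hB.pullback y (E.outerTmul u v) := by
  have h₁ : (B.dualRightBialgebroid hU).galois x = y ↔ opTensorPairing x = hB.pullback y := by
    constructor
    · rintro rfl
      have h : (opTensorPairing x).comp B.galois =
          innerPairing ((B.dualRightBialgebroid hU).galois x) :=
        BalTensor.hom_ext (fun u v => by
          rw [innerPairing_apply_tmul, coproductPairing_galois]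
          rfl)
      refine LinearMap.ext fun z => ?_
      obtain ⟨z, rfl⟩ := hB.2 z
      rw [pullback_galois, ← h, LinearMap.comp_apply]
    · intro h
      refine coproductPairing_ext hU fun u v => ?_
      rw [coproductPairing_galois, h, pullback_galois, innerPairing_apply_tmul]
  rw [h₁]
  constructor
  · intro h u v
    rw [← h, opTensorPairing_apply_tmul]
  · intro h
    exact BalTensor.hom_ext (fun u v => by rw [opTensorPairing_apply_tmul, h])

theorem dual_isRightHopf (hB : B.IsLeftHopf) (hU : E.RactFGProjective) :
    (B.dualRightBialgebroid hU).IsRightHopf := by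
  constructor
  · intro x x' hx
    refine translationPairing_ext hU fun u v => ?_
    rw [(hB.galois_eq_iff hU x _).1 hx, (hB.galois_eq_iff hU x' _).1 rfl]
  · intro y
    obtain ⟨n, e, e', he⟩ := B.exists_isDualBasis hU
    -- The preimage of `y` is the sum of the `eⁱ` tensored with the slices of the pulled-back
    -- function at the `eᵢ`.
    refine ⟨_, (hB.galois_eq_iff hU _ y).2 (translationPairing_sum_tmul he (hB.pullback y)
      (fun u => RightDual.mk
        ((hB.pullback y).comp (BalTensor.tmul E.outer.right E.outer.left u)) (fun v a => ?_))
      fun u v => rfl)⟩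
    have h := hB.pullback_sqRight y a (BalTensor.tmul E.outer.right E.outer.left u v)
    simpa [BimoduleStr.sqRight] using h

/-- The tensor `ε ⊗ φ` takes the value `ε(φ(y) ▶ x)` at `x ⊗ y`. The Galois map is right `U`-linear,
so the preimage of `u ⊗ v` is `u₊ ⊗ u₋v`, where this value is `(u ⇁ φ)(v)`. -/
theorem adjAct_apply (u : U) (φ : B.RightDual) (v : U) :
    hB.adjAct u φ v = hB.pullback (B.dualAeRing.innerTmul 1 φ) (E.outerTmul u v) := by
  have hw : ∀ (x : E.outer.Sq) (y : U),
      E.outerMulSnd x (y * v) = E.outerMulSnd (E.outerMulSnd x y) v := by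
    intro x y
    have e : E.outerMulSnd.flip (y * v) =
        (E.outerMulSnd.flip v).comp (E.outerMulSnd.flip y) :=
      BalTensor.hom_ext (fun p q => by
        have h₁ := E.outerMulSnd_tmul p q (y * v)
        have h₂ := E.outerMulSnd_tmul p q y
        have h₃ := E.outerMulSnd_tmul p (q * y) v
        simp only [AeRing.outerTmul] at h₁ h₂ h₃
        simp [h₁, h₂, h₃, mul_assoc])
    exact LinearMap.congr_fun e x
  have h : (B.adjPairing φ).flip v =
      (hB.pullback (B.dualAeRing.innerTmul 1 φ)).comp
        ((E.outerMulSnd.flip v).comp B.galois) :=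
    BalTensor.hom_ext (fun x y => by
      have h₁ := B.adjPairing_tmul φ x y v
      simp only [AeRing.opTmul] at h₁
      rw [LinearMap.flip_apply, h₁, LinearMap.comp_apply, LinearMap.comp_apply, galois_tmul,
        LinearMap.flip_apply, ← hw, ← galois_tmul, pullback_galois, innerPairing_apply_tmul,
        coproductPairing_tmul]
      rfl)
  have h' := LinearMap.congr_fun h (hB.translation u)
  rw [LinearMap.comp_apply, LinearMap.comp_apply, hB.galois_translation, LinearMap.flip_apply,
    LinearMap.flip_apply, E.outerMulSnd_tmul, one_mul] at h'
  exact h'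

theorem galois_sum_adjAct (hU : E.RactFGProjective) {n : ℕ} {e : Fin n → U}
    {e' : Fin n → B.RightDual} (h : IsDualBasis e e') (φ : B.RightDual) :
    (B.dualRightBialgebroid hU).galois
      (∑ i, B.dualAeRing.opTmul (e' i) (hB.adjAct (e i) φ)) = B.dualAeRing.innerTmul 1 φ :=
  (hB.galois_eq_iff hU _ _).2 (translationPairing_sum_tmul h _ (fun u => hB.adjAct u φ)
    fun u v => hB.adjAct_apply u φ v)

/-- The Galois map commutes with left multiplication by `φ` on the first factor, so this is `φ`
times the identity for `ε ⊗ ψ`. -/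
theorem galois_sum_mul_adjAct (hU : E.RactFGProjective) {n : ℕ} {e : Fin n → U}
    {e' : Fin n → B.RightDual} (h : IsDualBasis e e') (φ ψ : B.RightDual) :
    (B.dualRightBialgebroid hU).galois
      (∑ i, B.dualAeRing.opTmul (φ * e' i) (hB.adjAct (e i) ψ)) =
      B.dualAeRing.innerTmul φ ψ := by
  have h₁ := hB.galois_sum_adjAct hU h ψ
  simp only [map_sum, AeRing.opTmul, dual_galois_tmul] at h₁ ⊢
  simp only [innerMulFst_mul]
  rw [← LinearMap.sum_apply, ← map_sum, h₁, AeRing.innerMulFst_tmul, mul_one]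

end IsLeftHopf

end LeftBialgebroid

namespace RightBialgebroid.IsRightHopf

variable {k A V : Type*} [CommRing k] [Ring A] [Algebra k A] [Ring V] [Algebra k V]
  {E : AeRing k A V} {D : RightBialgebroid E}

theorem galoisInv_eq_iff (h : D.IsRightHopf) (x : E.OpTensor) (y : E.inner.Sq) :
    h.galoisInv y = x ↔ D.galois x = y := by
  refine ((LinearEquiv.ofBijective D.galois h).symm_apply_eq).trans ?_
  exact eq_comm

end RightBialgebroid.IsRightHopf

end

theorem theorem3p1 {k A U : Type*} [CommRing k] [Ring A] [Algebra k A] [Ring U] [Algebra k U]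
    (E : AeRing k A U) (B : LeftBialgebroid E) (hB : B.IsLeftHopf) (hU : E.RactFGProjective) :
    ∃ D : RightBialgebroid B.dualAeRing,
      (∀ φ : B.RightDual, D.counit φ = φ 1) ∧
      (∀ (φ : B.RightDual) (x : B.dualAeRing.inner.Sq),
        D.comul φ = x ↔ ∀ u v : U, B.coproductPairing u v x = φ (u * v)) ∧
      (∀ (n : ℕ) (e : Fin n → U) (e' : Fin n → B.RightDual),
        LeftBialgebroid.IsDualBasis e e' → ∀ φ : B.RightDual,
          D.comul φ = ∑ i, B.dualAeRing.innerTmul (B.rmulAct (e i) φ) (e' i)) ∧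
      ∃ hD : D.IsRightHopf,
        (∀ (φ : B.RightDual) (x : B.dualAeRing.OpTensor),
          hD.translation φ = x ↔ ∀ u v : U, B.translationPairing u v x = hB.adjAct u φ v) ∧
        (∀ (n : ℕ) (e : Fin n → U) (e' : Fin n → B.RightDual),
          LeftBialgebroid.IsDualBasis e e' → ∀ φ : B.RightDual,
            hD.translation φ = ∑ i, B.dualAeRing.opTmul (e' i) (hB.adjAct (e i) φ)) ∧
        (∀ (n : ℕ) (e : Fin n → U) (e' : Fin n → B.RightDual),
          LeftBialgebroid.IsDualBasis e e' → ∀ φ ψ : B.RightDual,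
            hD.galoisInv (B.dualAeRing.innerTmul φ ψ) =
              ∑ i, B.dualAeRing.opTmul (φ * e' i) (hB.adjAct (e i) ψ)) := by
  refine ⟨B.dualRightBialgebroid hU, fun φ => rfl,
    fun φ x => LeftBialgebroid.dualComul_eq_iff hU φ x, fun n e e' he φ => ?_,
    hB.dual_isRightHopf hU, fun φ x => ?_, fun n e e' he φ => ?_, fun n e e' he φ ψ => ?_⟩
  · exact (LeftBialgebroid.dualComul_eq_iff hU φ _).2
      (LeftBialgebroid.coproductPairing_sum_rmulAct he φ)
  · simp only [hB.adjAct_apply]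
    exact (RightBialgebroid.IsRightHopf.galoisInv_eq_iff _ _ _).trans (hB.galois_eq_iff hU _ _)
  · exact (RightBialgebroid.IsRightHopf.galoisInv_eq_iff _ _ _).2 (hB.galois_sum_adjAct hU he φ)
  · exact (RightBialgebroid.IsRightHopf.galoisInv_eq_iff _ _ _).2
      (hB.galois_sum_mul_adjAct hU he φ ψ)
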